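/- Conventions. Integers are written in binary with a sign bit, and "computable in polynomial time" means: by a (multi-tape) Turing machine whose number of steps is bounded by a polynomial in the quantity indicated. A real number $r$ is polynomial-time computable if there are integers $r_n$ ($n\in\mathbb N$), computable in time polynomial in $n$, with $|r-r_n/2^n|\le 2^{-n}$ for all $n$. For $f\in L^2[0,1]$ (complex-valued) let $\tilde f_k=\int_0^1 e^{-2\pi i k x}f(x)\,dx$ ($k\in\mathbb Z$) and $\mathcal F_K(f)(x)=\sum_{|k|\le K}\tilde f_k e^{2\pi i k x}$. Call $f$ Fourier-computable in polynomial time if (i) there are Gaussian integers $c_{k,n}\in\mathbb Z+i\mathbb Z$ ($k\in\mathbb Z$, $n\in\mathbb N$) with $|\tilde f_k-c_{k,n}/2^n|\le 2^{-n}$ for all $k,n$, such that (ii) both $(n,k)\mapsto\operatorname{Re}c_{k,n}$ and $(n,k)\mapsto\operatorname{Im}c_{k,n}$ are computable in time polynomial in $n+\log|k|$ (that is, in the length of the input $1^n0\,\mathrm{bin}(k)$), and (iii) there is a polynomial $p$ with coefficients in $\mathbb N$ such that $\|f-\mathcal F_{2^{p(m)}}(f)\|_{L^2[0,1]}\le 2^{-m}$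 for all $m\in\mathbb N$. A solution of the periodic heat equation with initial datum $f\in L^2[0,1]$ is a function $u(x,s)$, $x\in\mathbb R$, $s>0$, that is $1$-periodic in $x$, continuous together with its partial derivatives $u_x,u_{xx},u_s$, satisfies $u_s=u_{xx}$ for all $x\in\mathbb R$, $s>0$, and attains the initial datum in the sense that $\|u(\cdot,s)-f\|_{L^2[0,1]}\to0$ as $s\downarrow0$. Theorem. Let $t>0$ be a polynomial-time computable real number, and let $f\in L^2[0,1]$ be Fourier-computable in polynomial time. Then the periodic heat equation with initial datum $f$ has a solution $u$, this solution is unique, and $u(\cdot,t)$ is again Fourier-computable in polynomial time. -/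

import Mathlib

noncomputable section

open MeasureTheory Filter Topology

namespace PeriodicHeat

/-! ### Polynomial-time computability on Turing machines -/

/-- `f` is computed in polynomial time by a (finite, multi-stack) Turing machine, where arguments
are presented as the bit strings `ea a`, values as the bit strings `eb b`, and time is the number
of machine steps, bounded by a polynomial in the length of the input string. -/
def PolyTime {α β : Type} (ea : α → List Bool) (eb : β → List Bool) (f : α → β) : Prop :=
  Nonempty (Turing.TM2ComputableInPolyTime ea eb f)

/-- Sign bit (`true` for negative integers), followed by the binary digits of the absolute value. -/
def encodeInt (z : ℤ) : List Bool :=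
  decide (z < 0) :: Computability.encodeNat z.natAbs

/-- The word `1ⁿ`, so that polynomial in its length means polynomial in `n`. -/
def encodeUnary (n : ℕ) : List Bool :=
  List.replicate n true

/-- The word `1ⁿ 0 bin(k)`, so that polynomial in its length means polynomial in `n + log |k|`. -/
def encodeIndex (p : ℕ × ℤ) : List Bool :=
  List.replicate p.1 true ++ false :: encodeInt p.2

/-- The real number `r` is polynomial-time computable: some machine produces, in time polynomial
in `n`, an integer `a n` with `|r - a n / 2 ^ n| ≤ 2 ^ (-n)`. -/
def PolyTimeReal (r : ℝ) : Prop :=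
  ∃ a : ℕ → ℤ, (∀ n, |r - (a n : ℝ) / 2 ^ n| ≤ 1 / 2 ^ n) ∧ PolyTime encodeUnary encodeInt a

/-! ### Fourier series on the unit interval -/

/-- Lebesgue measure on the unit interval. -/
def unitMeasure : Measure ℝ :=
  volume.restrict (Set.Icc 0 1)

/-- The `k`-th Fourier coefficient `∫₀¹ exp(-2πikx) f(x) dx`. -/
def fourierCoefficient (f : ℝ → ℂ) (k : ℤ) : ℂ :=
  ∫ x, Complex.exp (-(2 * Real.pi * Complex.I * k * x)) * f x ∂unitMeasure

/-- The Fourier partial sum over all `|k| ≤ K`. -/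
def fourierPartialSum (f : ℝ → ℂ) (K : ℕ) (x : ℝ) : ℂ :=
  ∑ k ∈ Finset.Icc (-(K : ℤ)) K,
    fourierCoefficient f k * Complex.exp (2 * Real.pi * Complex.I * k * x)

/-- `f`, regarded as an element of `L²[0,1]`, is Fourier-computable in polynomial time. -/
structure FourierPolyTime (f : ℝ → ℂ) : Prop where
  memLp : MemLp f 2 unitMeasure
  approx : ∃ c : ℤ → ℕ → GaussianInt,
    (∀ k n, ‖fourierCoefficient f k - GaussianInt.toComplex (c k n) / 2 ^ n‖ ≤ 1 / 2 ^ n) ∧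
    PolyTime encodeIndex encodeInt (fun p => (c p.2 p.1).re) ∧
    PolyTime encodeIndex encodeInt (fun p => (c p.2 p.1).im)
  tail : ∃ q : Polynomial ℕ, ∀ m : ℕ,
    eLpNorm (fun x => f x - fourierPartialSum f (2 ^ q.eval m) x) 2 unitMeasure ≤
      ENNReal.ofReal (1 / 2 ^ m)

/-! ### The periodic heat equation -/

/-- `u x t` solves `u_t = u_xx` for `t > 0` classically (with `u_x`, `u_xx`, hence also `u_t`,
continuous), is 1-periodic in `x`, and attains the initial datum `f` in the sense of `L²[0,1]`
as `t` decreases to `0`. Only the values of `u` at times `t > 0` matter. -/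
structure IsHeatSolution (f : ℝ → ℂ) (u : ℝ → ℝ → ℂ) : Prop where
  periodic : ∀ x t, 0 < t → u (x + 1) t = u x t
  continuousOn : ContinuousOn (Function.uncurry u) (Set.univ ×ˢ Set.Ioi 0)
  equation : ∃ ux uxx : ℝ → ℝ → ℂ,
    ContinuousOn (Function.uncurry ux) (Set.univ ×ˢ Set.Ioi 0) ∧
    ContinuousOn (Function.uncurry uxx) (Set.univ ×ˢ Set.Ioi 0) ∧
    ∀ x t, 0 < t →
      HasDerivAt (fun y => u y t) (ux x t) x ∧
      HasDerivAt (fun y => ux y t) (uxx x t) x ∧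
      HasDerivAt (fun s => u x s) (uxx x t) t
  initial : Tendsto (fun t => eLpNorm (fun x => u x t - f x) 2 unitMeasure) (𝓝[>] 0) (𝓝 0)

end PeriodicHeat

end

/-!
Multiplying the `k`-th Fourier coefficient of `f` by `exp(-4π²k²s)` gives a series that converges
together with all its derivatives, locally uniformly for `s > 0`, hence a solution of the heat
equation. Conversely, by integration by parts the `k`-th Fourier coefficient `a` of any solution
satisfies `a' = -4π²k²a`, and its limit for `s ↓ 0` is the `k`-th Fourier coefficient of `f`; since
a continuous periodic function is determined by its Fourier coefficients, the solution is unique.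

For the complexity bound, `4π²t` is a product of polynomial-time computable reals, where
`π = 4 (arctan (1 / 2) + arctan (1 / 3))`. For `x ≥ 0`, `exp(-x)` is approximated by
`(1 - x / 2^d)^(2^d)`, that is by `d` squarings, where `d = O(n + log |k|)` suffices for
`x = 4π²tk²` and the error `2^(-n)`. The tail is small because of the damping alone: outside
`|k| ≤ K` all factors are at most `1 / (4π²tK²)`.

Machines that are known to run in polynomial time are combined as subroutines of a larger machine,
which shows that the polynomial-time functions are closed under composition, pairing and recursion
along a unary argument with results of polynomial length. Binary arithmetic is obtained from these
closure properties and from finite transducers.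
-/

noncomputable section

namespace PeriodicHeat

/-! ### Programs of stack machines -/

section Machines

open Turing

section Runs

variable {K : Type} [DecidableEq K] {Γ : K → Type} {Λ σ : Type}

/-- The program `M` takes one configuration to another in at most `t` steps. -/
inductive RunsWithin (M : Λ → TM2.Stmt Γ Λ σ) : ℕ → TM2.Cfg Γ Λ σ → TM2.Cfg Γ Λ σ → Prop
  | refl (t : ℕ) (c : TM2.Cfg Γ Λ σ) : RunsWithin M t c c
  | head {t : ℕ} {l : Λ} {v : σ} {S : ∀ k, List (Γ k)} {c : TM2.Cfg Γ Λ σ} :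
    RunsWithin M t (TM2.stepAux (M l) v S) c → RunsWithin M (t + 1) ⟨some l, v, S⟩ c

variable {M : Λ → TM2.Stmt Γ Λ σ} {t t' : ℕ} {c c' c'' : TM2.Cfg Γ Λ σ}

theorem runsWithin_iff_exists_iterate :
    RunsWithin M t c c' ↔ ∃ n ≤ t, (flip bind (TM2.step M))^[n] (some c) = some c' := by
  constructor
  · intro h
    induction h with
    | refl t c => exact ⟨0, t.zero_le, rfl⟩
    | head _ ih =>
      obtain ⟨n, hn, h⟩ := ih
      exact ⟨n + 1, by omega, by rw [Function.iterate_succ_apply]; exact h⟩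
  · rintro ⟨n, hn, h⟩
    induction n generalizing t c with
    | zero => obtain rfl := Option.some.inj h; exact .refl t c
    | succ n ih =>
      obtain ⟨t, rfl⟩ := Nat.exists_eq_add_of_le' (n.succ_pos.trans_le hn)
      rw [Function.iterate_succ_apply] at h
      obtain ⟨_ | l, v, S⟩ := c
      · have : (flip bind (TM2.step M))^[n] none = none := Function.iterate_fixed rfl n
        exact absurd (this.symm.trans h) (Option.some_ne_none _).symm
      · exact .head (ih (by omega) h)

namespace RunsWithin

theorem mono (h : RunsWithin M t c c') (ht : t ≤ t') : RunsWithin M t' c c' := by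
  obtain ⟨n, hn, h⟩ := runsWithin_iff_exists_iterate.1 h
  exact runsWithin_iff_exists_iterate.2 ⟨n, hn.trans ht, h⟩

theorem trans (h : RunsWithin M t c c') (h' : RunsWithin M t' c' c'') :
    RunsWithin M (t + t') c c'' := by
  induction h with
  | refl t c => exact h'.mono (by omega)
  | head _ ih => exact (head (ih h')).mono (by omega)

theorem single {l : Λ} {v : σ} {S : ∀ k, List (Γ k)} (h : TM2.stepAux (M l) v S = c) :
    RunsWithin M 1 ⟨some l, v, S⟩ c :=
  head (h ▸ refl 0 _)

theorem map {K' : Type} [DecidableEq K'] {Γ' : K' → Type} {Λ' σ' : Type}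
    {M' : Λ' → TM2.Stmt Γ' Λ' σ'} {φ : TM2.Cfg Γ Λ σ → TM2.Cfg Γ' Λ' σ'}
    (hφ : ∀ l v S, RunsWithin M' 1 (φ ⟨some l, v, S⟩) (φ (TM2.stepAux (M l) v S)))
    (h : RunsWithin M t c c') : RunsWithin M' t (φ c) (φ c') := by
  induction h with
  | refl t c => exact refl t _
  | head _ ih => exact ((hφ _ _ _).trans ih).mono (by omega)

end RunsWithin

/-- An upper bound for the number of symbols that a statement pushes. -/
def pushCount : TM2.Stmt Γ Λ σ → ℕ
  | .push _ _ q => pushCount q + 1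
  | .peek _ _ q => pushCount q
  | .pop _ _ q => pushCount q
  | .load _ q => pushCount q
  | .branch _ q₁ q₂ => pushCount q₁ + pushCount q₂
  | .goto _ => 0
  | .halt => 0

theorem length_update_le {k k' : K} {S : ∀ k, List (Γ k)} {w : List (Γ k')} {n : ℕ}
    (hw : w.length ≤ (S k').length + n) :
    (Function.update S k' w k).length ≤ (S k).length + n := by
  by_cases h : k = k'
  · subst h; simpa using hw
  · simp [Function.update_of_ne h]

theorem length_stepAux_le (q : TM2.Stmt Γ Λ σ) (v : σ) (S : ∀ k, List (Γ k)) (k : K) :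
    ((TM2.stepAux q v S).stk k).length ≤ (S k).length + pushCount q := by
  induction q generalizing v S with
  | push k' f q ih =>
    have := length_update_le (k := k) (S := S) (w := f v :: S k') (n := 1) (by simp)
    exact (ih _ _).trans (by rw [pushCount]; omega)
  | peek _ _ _ ih => exact ih _ _
  | pop k' f q ih =>
    have := length_update_le (k := k) (S := S) (w := (S k').tail) (n := 0) (by simp)
    exact (ih _ _).trans (by rw [pushCount]; omega)
  | load _ _ ih => exact ih _ _
  | branch f q₁ q₂ ih₁ ih₂ =>
    simp only [TM2.stepAux, pushCount]
    cases f v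
    · exact (ih₂ _ _).trans (by omega)
    · exact (ih₁ _ _).trans (by omega)
  | goto l => simp [pushCount]
  | halt => simp [pushCount]

theorem RunsWithin.length_stk_le {C : ℕ} (hC : ∀ l, pushCount (M l) ≤ C)
    (h : RunsWithin M t c c') (k : K) : (c'.stk k).length ≤ (c.stk k).length + C * t := by
  induction h with
  | refl t c => exact Nat.le_add_right _ _
  | @head t l v S _ _ ih =>
    have := length_stepAux_le (M l) v S k
    have := hC l
    rw [Nat.mul_succ]
    dsimp only
    omega

end Runs

section PolyBounded

variable {α : Type} {x y : α → List Bool} {f g : α → ℕ}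

theorem monotone_eval (p : Polynomial ℕ) : Monotone (fun n => p.eval n) := fun m n h => by
  simp only [Polynomial.eval_eq_sum_range]
  gcongr

/-- `g` is bounded by a polynomial in the length of `x`. -/
def PolyBounded (x : α → List Bool) (g : α → ℕ) : Prop :=
  ∃ p : Polynomial ℕ, ∀ a, g a ≤ p.eval (x a).length

namespace PolyBounded

theorem mono (h : PolyBounded x g) (hf : ∀ a, f a ≤ g a) : PolyBounded x f :=
  h.imp fun _ hp a => (hf a).trans (hp a)

theorem const (c : ℕ) : PolyBounded x (fun _ => c) :=
  ⟨Polynomial.C c, fun a => by simp⟩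

theorem length : PolyBounded x (fun a => (x a).length) :=
  ⟨Polynomial.X, fun a => by simp⟩

theorem add (hf : PolyBounded x f) (hg : PolyBounded x g) : PolyBounded x (fun a => f a + g a) := by
  obtain ⟨p, hp⟩ := hf
  obtain ⟨q, hq⟩ := hg
  exact ⟨p + q, fun a => by simpa using Nat.add_le_add (hp a) (hq a)⟩

theorem mul (hf : PolyBounded x f) (hg : PolyBounded x g) : PolyBounded x (fun a => f a * g a) := by
  obtain ⟨p, hp⟩ := hf
  obtain ⟨q, hq⟩ := hg
  exact ⟨p * q, fun a => by simpa using Nat.mul_le_mul (hp a) (hq a)⟩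

theorem eval (h : PolyBounded x g) (p : Polynomial ℕ) : PolyBounded x (fun a => p.eval (g a)) := by
  obtain ⟨q, hq⟩ := h
  exact ⟨p.comp q, fun a => by rw [Polynomial.eval_comp]; exact monotone_eval p (hq a)⟩

theorem trans (h : PolyBounded y g) (hy : PolyBounded x (fun a => (y a).length)) :
    PolyBounded x g := by
  obtain ⟨p, hp⟩ := h
  exact (hy.eval p).mono hp

end PolyBounded

end PolyBounded

section Computes

variable {α β : Type} {x y : α → List Bool}

/-- `y a` is computed from `x a` on a Turing machine, in time polynomial in the length of `x a`. -/
def Computes (x y : α → List Bool) : Prop :=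
  PolyTime x y (fun a => a)

theorem polyTime_iff_computes {z : β → List Bool} {f : α → β} :
    PolyTime x z f ↔ Computes x (fun a => z (f a)) :=
  ⟨fun ⟨M, t, h⟩ => ⟨M, t, h⟩, fun ⟨M, t, h⟩ => ⟨M, t, h⟩⟩

/-- The stacks of a machine of which only the stack `k` is in use, holding the bit string `l`. -/
def soloStack {K : Type} [DecidableEq K] {Γ : K → Type} (k : K) (e : Γ k ≃ Bool) (l : List Bool) :
    ∀ k, List (Γ k) :=
  Function.update (fun _ => []) k (l.map e.symm)

theorem initList_eq_soloStack (tm : FinTM2) (e : tm.Γ tm.k₀ ≃ Bool) (l : List Bool) :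
    initList tm (l.map e.invFun) = ⟨some tm.main, tm.initialState, soloStack tm.k₀ e l⟩ := by
  unfold initList soloStack
  congr 1
  funext k
  by_cases h : k = tm.k₀
  · subst h; simp
  · simp [h]

theorem haltList_eq_soloStack (tm : FinTM2) (e : tm.Γ tm.k₁ ≃ Bool) (l : List Bool) :
    haltList tm (l.map e.invFun) = ⟨none, tm.initialState, soloStack tm.k₁ e l⟩ := by
  unfold haltList soloStack
  congr 1
  funext k
  by_cases h : k = tm.k₁
  · subst h; simp
  · simp [h]

/-- Started on the input `l`, the machine `M` halts with the output `l'` after at most `t` steps. -/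
def OutputsWithin (M : TM2ComputableAux Bool Bool) (t : ℕ) (l l' : List Bool) : Prop :=
  RunsWithin M.tm.m t ⟨some M.tm.main, M.tm.initialState, soloStack M.tm.k₀ M.inputAlphabet l⟩
    ⟨none, M.tm.initialState, soloStack M.tm.k₁ M.outputAlphabet l'⟩

/-- The machine `M` computes `y a` from `x a` in time polynomial in the length of `x a`. -/
def ComputedBy (M : TM2ComputableAux Bool Bool) (x y : α → List Bool) : Prop :=
  ∃ p : Polynomial ℕ, ∀ a, OutputsWithin M (p.eval (x a).length) (x a) (y a)

theorem computes_iff_exists_computedBy : Computes x y ↔ ∃ M, ComputedBy M x y := by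
  unfold ComputedBy OutputsWithin
  simp only [← initList_eq_soloStack, ← haltList_eq_soloStack]
  constructor
  · rintro ⟨⟨M, p, h⟩⟩
    exact ⟨M, p, fun a => runsWithin_iff_exists_iterate.2
      ⟨(h a).steps, (h a).steps_le_m, (h a).evals_in_steps⟩⟩
  · rintro ⟨M, p, h⟩
    choose n hn hsteps using fun a => runsWithin_iff_exists_iterate.1 (h a)
    exact ⟨⟨M, p, fun a => ⟨⟨n a, hsteps a⟩, hn a⟩⟩⟩

theorem OutputsWithin.length_le {M : TM2ComputableAux Bool Bool} {C t : ℕ} {l l' : List Bool}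
    (hC : ∀ q, pushCount (M.tm.m q) ≤ C) (h : OutputsWithin M t l l') :
    l'.length ≤ l.length + C * t := by
  have hout := h.length_stk_le hC M.tm.k₁
  have hin : (soloStack M.tm.k₀ M.inputAlphabet l M.tm.k₁).length ≤ 0 + l.length :=
    length_update_le (S := fun _ => []) (by simp)
  simp only [soloStack, Function.update_self, List.length_map] at hout hin
  omega

theorem ComputedBy.polyBounded {M : TM2ComputableAux Bool Bool} (h : ComputedBy M x y) :
    PolyBounded x (fun a => (y a).length) := by
  obtain ⟨p, h⟩ := h
  have := M.tm.ΛFin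
  obtain ⟨C, hC⟩ := (Set.finite_range fun l => pushCount (M.tm.m l)).bddAbove
  exact (PolyBounded.length.add ((PolyBounded.const C).mul (PolyBounded.length.eval p))).mono
    fun a => (h a).length_le fun l => hC ⟨l, rfl⟩

namespace Computes

theorem refl (x : α → List Bool) : Computes x x :=
  ⟨idComputableInPolyTime x⟩

theorem of_eq {x' y' : α → List Bool} (h : Computes x y) (hx : ∀ a, x' a = x a)
    (hy : ∀ a, y' a = y a) : Computes x' y' := by
  obtain rfl : x' = x := funext hx
  obtain rfl : y' = y := funext hy
  exact h

theorem comp (h : Computes x y) (f : β → α) :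
    Computes (fun b => x (f b)) (fun b => y (f b)) := by
  obtain ⟨M, p, h⟩ := computes_iff_exists_computedBy.1 h
  exact computes_iff_exists_computedBy.2 ⟨M, p, fun b => h (f b)⟩

theorem polyBounded (h : Computes x y) : PolyBounded x (fun a => (y a).length) :=
  let ⟨_, hM⟩ := computes_iff_exists_computedBy.1 h
  hM.polyBounded

end Computes

end Computes

section PushAll

variable {K : Type} [DecidableEq K] {Γ : K → Type} {Λ σ : Type}

/-- The statement that puts the first `n` symbols of the word `f v` on top of the stack `k`. -/
def pushAll (k : K) (f : σ → List (Γ k)) (d : Γ k) : ℕ → TM2.Stmt Γ Λ σ → TM2.Stmt Γ Λ σ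
  | 0, q => q
  | n + 1, q =>
    .branch (fun v => decide (n < (f v).length))
      (.push k (fun v => (f v).getD n d) (pushAll k f d n q)) (pushAll k f d n q)

theorem stepAux_pushAll (k : K) (f : σ → List (Γ k)) (d : Γ k) (n : ℕ) (q : TM2.Stmt Γ Λ σ)
    (v : σ) (S : ∀ k, List (Γ k)) :
    TM2.stepAux (pushAll k f d n q) v S =
      TM2.stepAux q v (Function.update S k ((f v).take n ++ S k)) := by
  induction n generalizing S with
  | zero => simp [pushAll]
  | succ n ih =>
    by_cases h : n < (f v).length
    · simp only [pushAll, TM2.stepAux, h, decide_true, cond_true, ih, Function.update_self,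
        Function.update_idem]
      rw [List.take_add_one, List.getD_eq_getElem _ _ h, List.getElem?_eq_getElem h,
        Option.toList_some, List.append_assoc, List.singleton_append]
    · simp only [pushAll, TM2.stepAux, h, decide_false, cond_false, ih]
      rw [List.take_of_length_le (by omega), List.take_of_length_le (by omega)]

end PushAll

/-- A sequential transducer: it reads a word from left to right, writing `emit q b` when it reads
the letter `b` in the state `q`, and `final q` if it is in the state `q` at the end of the input. -/
structure Transducer where
  Q : Type
  [fin : Fintype Q]
  start : Q
  next : Q → Bool → Q
  emit : Q → Bool → List Bool
  final : Q → List Bool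
  width : ℕ
  emit_le : ∀ q b, (emit q b).length ≤ width
  final_le : ∀ q, (final q).length ≤ width

namespace Transducer

variable (T : Transducer)

/-- The output of a transducer started in state `q`. -/
def out (q : T.Q) : List Bool → List Bool
  | [] => T.final q
  | b :: l => T.emit q b ++ out (T.next q b) l

theorem length_out_le (q : T.Q) (l : List Bool) :
    (T.out q l).length ≤ T.width * (l.length + 1) := by
  induction l generalizing q with
  | nil => simpa [out] using T.final_le q
  | cons b l ih =>
    have := ih (T.next q b)
    have := T.emit_le q b
    rw [out, List.length_append, List.length_cons, Nat.mul_succ]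
    omega

/-- The program of a machine with two stacks that executes a transducer. Under the label `true` it
reads the input and collects the output in reverse, under the label `false` it reverses the
output. -/
def program : Bool → TM2.Stmt (fun _ : Bool => Bool) Bool (T.Q × Option Bool)
  | true =>
    .pop true (fun v o => (v.1, o)) <|
    .branch (fun v => v.2.isSome)
      (pushAll false (fun v => (T.emit v.1 (v.2.getD false)).reverse) false T.width <|
        .load (fun v => (T.next v.1 (v.2.getD false), none)) <|
        .goto fun _ => true)
      (pushAll false (fun v => (T.final v.1).reverse) false T.width <|
        .goto fun _ => false)
  | false =>
    .pop false (fun v o => (v.1, o)) <|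
    .branch (fun v => v.2.isSome)
      (.push true (fun v => v.2.getD false) <| .goto fun _ => false)
      (.load (fun _ => (T.start, none)) .halt)

/-- The machine with two stacks that executes a transducer. -/
def machine : TM2ComputableAux Bool Bool where
  tm :=
    { K := Bool
      k₀ := true
      k₁ := true
      Γ := fun _ => Bool
      Λ := Bool
      main := true
      σ := T.Q × Option Bool
      initialState := (T.start, none)
      σFin := by have := T.fin; infer_instance
      m := T.program }
  inputAlphabet := Equiv.refl _
  outputAlphabet := Equiv.refl _

/-- The two stacks of the machine that executes a transducer: `l` holds the input and the final
output, `r` the reversed output. -/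
def twoStacks (l r : List Bool) (b : Bool) : List Bool :=
  cond b l r

theorem update_twoStacks_true (l l' r : List Bool) :
    Function.update (twoStacks l r) true l' = twoStacks l' r := by
  funext b; cases b <;> rfl

theorem update_twoStacks_false (l r r' : List Bool) :
    Function.update (twoStacks l r) false r' = twoStacks l r' := by
  funext b; cases b <;> rfl

theorem soloStack_eq_twoStacks (l : List Bool) :
    soloStack (Γ := fun _ : Bool => Bool) true (Equiv.refl Bool) l = twoStacks l [] := by
  funext b
  cases b <;> simp [soloStack, twoStacks]

theorem runsWithin_read (q : T.Q) (o : Option Bool) (l r : List Bool) :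
    ∃ q', RunsWithin T.program (l.length + 1) ⟨some true, (q, o), twoStacks l r⟩
      ⟨some false, (q', none), twoStacks [] ((T.out q l).reverse ++ r)⟩ := by
  induction l generalizing q o r with
  | nil =>
    refine ⟨q, .single ?_⟩
    have hlen := (T.final q).length_reverse.trans_le (T.final_le q)
    simp [program, twoStacks, stepAux_pushAll, update_twoStacks_true, update_twoStacks_false,
      List.take_of_length_le hlen, out]
  | cons b l ih =>
    obtain ⟨q', h⟩ := ih (T.next q b) none ((T.emit q b).reverse ++ r)
    have hlen := (T.emit q b).length_reverse.trans_le (T.emit_le q b)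
    refine ⟨q', .head ?_⟩
    simpa [program, twoStacks, stepAux_pushAll, update_twoStacks_true, update_twoStacks_false,
      List.take_of_length_le hlen, out] using h

theorem runsWithin_reverse (q : T.Q) (o : Option Bool) (l r : List Bool) :
    RunsWithin T.program (r.length + 1) ⟨some false, (q, o), twoStacks l r⟩
      ⟨none, (T.start, none), twoStacks (r.reverse ++ l) []⟩ := by
  induction r generalizing l o with
  | nil => exact .single (by simp [program, twoStacks, update_twoStacks_false])
  | cons b r ih =>
    refine .head ?_
    simpa [program, twoStacks, update_twoStacks_true, update_twoStacks_false]
      using ih (some b) (b :: l)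

theorem outputsWithin (l : List Bool) :
    OutputsWithin T.machine (l.length + 1 + (T.width * (l.length + 1) + 1)) l
      (T.out T.start l) := by
  obtain ⟨q, hread⟩ := T.runsWithin_read T.start none l []
  have hreverse := T.runsWithin_reverse q none [] ((T.out T.start l).reverse ++ [])
  have h := hread.trans hreverse
  simp only [List.append_nil, List.reverse_reverse, List.length_reverse,
    ← soloStack_eq_twoStacks] at h
  have := T.length_out_le T.start l
  exact h.mono (by omega)

theorem computes {α : Type} (x : α → List Bool) : Computes x (fun a => T.out T.start (x a)) :=
  computes_iff_exists_computedBy.2 ⟨T.machine, Polynomial.X + 1 +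
    (Polynomial.C T.width * (Polynomial.X + 1) + 1), fun a => by
      simpa using T.outputsWithin (x a)⟩

end Transducer

section Routine

variable {K : Type} [DecidableEq K] {Γ : K → Type} {Λ Λ' σ : Type}

/-- Rename the labels of a statement, and jump to `exit` instead of halting if `exit` is a label. -/
def relabel (g : Λ → Λ') (exit : Option Λ') : TM2.Stmt Γ Λ σ → TM2.Stmt Γ Λ' σ
  | .push k f q => .push k f (relabel g exit q)
  | .peek k f q => .peek k f (relabel g exit q)
  | .pop k f q => .pop k f (relabel g exit q)
  | .load f q => .load f (relabel g exit q)
  | .branch f q₁ q₂ => .branch f (relabel g exit q₁) (relabel g exit q₂)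
  | .goto l => .goto fun v => g (l v)
  | .halt => exit.elim .halt fun l => .goto fun _ => l

/-- The effect on configurations of renaming labels as in `relabel`. -/
def relabelCfg (g : Λ → Λ') (exit : Option Λ') (c : TM2.Cfg Γ Λ σ) : TM2.Cfg Γ Λ' σ :=
  ⟨c.l.elim exit fun l => some (g l), c.var, c.stk⟩

theorem stepAux_relabel (g : Λ → Λ') (exit : Option Λ') (q : TM2.Stmt Γ Λ σ) (v : σ)
    (S : ∀ k, List (Γ k)) :
    TM2.stepAux (relabel g exit q) v S = relabelCfg g exit (TM2.stepAux q v S) := by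
  induction q generalizing v S with
  | push _ _ _ ih => exact ih _ _
  | peek _ _ _ ih => exact ih _ _
  | pop _ _ _ ih => exact ih _ _
  | load _ _ ih => exact ih _ _
  | branch f q₁ q₂ ih₁ ih₂ => cases h : f v <;> simp [relabel, h, ih₁, ih₂]
  | goto l => rfl
  | halt => cases exit <;> rfl

theorem RunsWithin.relabel {g : Λ → Λ'} {exit : Option Λ'} {M : Λ → TM2.Stmt Γ Λ σ}
    {M' : Λ' → TM2.Stmt Γ Λ' σ} (hM : ∀ l, M' (g l) = relabel g exit (M l)) {t : ℕ}
    {c c' : TM2.Cfg Γ Λ σ} (h : RunsWithin M t c c') :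
    RunsWithin M' t (relabelCfg g exit c) (relabelCfg g exit c') :=
  h.map fun l v S => .single (by rw [hM, stepAux_relabel])

/-- A program fragment for a machine with stacks `Γ`, whose internal state consists of an element
of `W` and a register for a letter. Control enters at `main`, and leaves by halting. -/
structure Routine (Γ : K → Type) (W : Type) where
  Λ : Type
  [fin : Fintype Λ]
  main : Λ
  code : Λ → TM2.Stmt Γ Λ (W × Option Bool)

namespace Routine

variable {W : Type} {w : W} {o : Option Bool} {t t' : ℕ} {S S' S'' : ∀ k, List (Γ k)}

/-- Entered with the letter `o` in the register and the stacks `S`, the routine exits after at most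
`t` steps with an empty register and the stacks `S'`. The state is `w` at both times. -/
def Runs (R : Routine Γ W) (w : W) (o : Option Bool) (t : ℕ) (S S' : ∀ k, List (Γ k)) : Prop :=
  RunsWithin R.code t ⟨some R.main, (w, o), S⟩ ⟨none, (w, none), S'⟩

theorem Runs.mono {R : Routine Γ W} (h : R.Runs w o t S S') (ht : t ≤ t') :
    R.Runs w o t' S S' :=
  RunsWithin.mono h ht

/-- The routine that executes one statement. -/
def single (q : TM2.Stmt Γ Unit (W × Option Bool)) : Routine Γ W where
  Λ := Unit
  main := ()
  code _ := q

/-- Execute two routines one after the other. -/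
def seq (R R' : Routine Γ W) : Routine Γ W where
  Λ := R.Λ ⊕ R'.Λ
  fin := by have := R.fin; have := R'.fin; infer_instance
  main := .inl R.main
  code := Sum.elim (fun l => relabel .inl (some (.inr R'.main)) (R.code l))
    (fun l => relabel .inr none (R'.code l))

theorem Runs.seq {R R' : Routine Γ W} (h : R.Runs w o t S S') (h' : R'.Runs w none t' S' S'') :
    (R.seq R').Runs w o (t + t') S S'' :=
  (RunsWithin.relabel (M' := (R.seq R').code) (fun _ => rfl) h).trans
    (RunsWithin.relabel (M' := (R.seq R').code) (fun _ => rfl) h')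

/-- Empty the stack `k`, executing `R` with each letter in the register after its removal. -/
def forEach (k : K) (e : Γ k ≃ Bool) (R : Routine Γ W) : Routine Γ W where
  Λ := Option R.Λ
  fin := by have := R.fin; infer_instance
  main := none
  code := Option.rec
    (.pop k (fun v a => (v.1, a.map e)) <|
      .branch (fun v => v.2.isSome) (.goto fun _ => some R.main) .halt)
    (fun l => relabel some (some none) (R.code l))

theorem forEach_runs {k : K} {e : Γ k ≃ Bool} {R : Routine Γ W}
    (F : List Bool → ∀ k, List (Γ k)) (l d : List Bool)
    (hR : ∀ d' b l', d'.reverse ++ b :: l' = d.reverse ++ l →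
      R.Runs w (some b) t (Function.update (F d') k (l'.map e.symm))
        (Function.update (F (b :: d')) k (l'.map e.symm))) (o : Option Bool) :
    (forEach k e R).Runs w o (l.length * (t + 1) + 1)
      (Function.update (F d) k (l.map e.symm))
      (Function.update (F (l.reverse ++ d)) k []) := by
  induction l generalizing d o with
  | nil => exact RunsWithin.mono (.single (by simp [forEach])) (Nat.le_add_left 1 _)
  | cons b l ih =>
    have hbody : RunsWithin (forEach k e R).code t _ _ :=
      RunsWithin.relabel (g := some) (exit := some none) (fun _ => rfl) (hR d b l rfl)
    have hrest := ih (b :: d) (fun d' b' l' h => hR d' b' l' (by simpa using h)) none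
    have h := hbody.trans hrest
    refine RunsWithin.mono (.head (t := t + (l.length * (t + 1) + 1)) ?_)
      (by rw [List.length_cons, Nat.succ_mul]; omega)
    simpa [forEach, relabelCfg] using h

/-- Push the letter in the register onto the stack `k`. -/
def put (k : K) (e : Γ k ≃ Bool) : Routine Γ W :=
  single <| .push k (fun v => e.symm (v.2.getD false)) <| .load (fun v => (v.1, none)) .halt

/-- Move the content of the stack `k` onto the stack `k'`, reversing it. -/
def move (k : K) (e : Γ k ≃ Bool) (k' : K) (e' : Γ k' ≃ Bool) : Routine Γ W :=
  forEach k e (put k' e')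

theorem move_runs {k k' : K} (hk : k ≠ k') (e : Γ k ≃ Bool) (e' : Γ k' ≃ Bool) (l : List Bool)
    (hS : S k = []) :
    (move (W := W) k e k' e').Runs w o (2 * l.length + 1) (Function.update S k (l.map e.symm))
      (Function.update S k' (l.reverse.map e'.symm ++ S k')) := by
  have h := forEach_runs (w := w) (e := e) (t := 1) (R := put k' e')
    (fun d => Function.update S k' (d.map e'.symm ++ S k')) l [] (fun d b l' _ => ?_) o
  · rw [List.map_nil, List.nil_append, Function.update_eq_self, List.append_nil,
      Function.update_comm hk.symm, ← hS, Function.update_eq_self] at h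
    exact h.mono (by omega)
  · refine .single ?_
    simp [put, single, Function.update_of_ne hk.symm, Function.update_comm hk]

/-- Move the content of the stack `k` onto the stack `k'` in the same order, by way of the empty
stack `s`. -/
def transfer (k : K) (e : Γ k ≃ Bool) (s : K) (e'' : Γ s ≃ Bool) (k' : K) (e' : Γ k' ≃ Bool) :
    Routine Γ W :=
  (move k e s e'').seq (move s e'' k' e')

theorem transfer_runs {k s k' : K} (hks : k ≠ s) (hsk' : s ≠ k') (e : Γ k ≃ Bool)
    (e'' : Γ s ≃ Bool) (e' : Γ k' ≃ Bool) (l : List Bool) (hk : S k = []) (hs : S s = []) :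
    (transfer (W := W) k e s e'' k' e').Runs w o (4 * l.length + 2)
      (Function.update S k (l.map e.symm))
      (Function.update S k' (l.map e'.symm ++ S k')) := by
  have hto := move_runs (w := w) (o := o) hks e e'' l hk
  have hfrom := move_runs (w := w) (o := none) hsk' e'' e' l.reverse hs
  rw [hs, List.append_nil] at hto
  rw [List.reverse_reverse] at hfrom
  exact (hto.seq hfrom).mono (by rw [List.length_reverse]; omega)

end Routine

end Routine

section Host

variable {ι : Type} [DecidableEq ι] (O : ι → TM2ComputableAux Bool Bool)

/-- The stacks of a machine with the subroutines `O i`: those of the `O i`, and three registers,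
numbered by `Fin 3`, of which `2` is for intermediate storage. -/
abbrev HostK : Type :=
  (Σ i, (O i).tm.K) ⊕ Fin 3

/-- The alphabets of the stacks `HostK O`. -/
@[reducible] def HostΓ : HostK O → Type
  | .inl p => (O p.1).tm.Γ p.2
  | .inr _ => Bool

/-- The joint internal states of the machines `O i`. -/
abbrev HostState : Type :=
  ∀ i, (O i).tm.σ

/-- The state in which every `O i` is ready to be called. -/
def idleState : HostState O := fun i =>
  (O i).tm.initialState

variable {O}

/-- Stack contents, composed of those of the `O i` and those of the registers. -/
def hostStacks (T : ∀ i k, List ((O i).tm.Γ k)) (ρ : Fin 3 → List Bool) :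
    ∀ k, List (HostΓ O k)
  | .inl p => T p.1 p.2
  | .inr j => ρ j

/-- Stack contents between two calls. -/
abbrev regStacks (ρ : Fin 3 → List Bool) : ∀ k, List (HostΓ O k) :=
  hostStacks (fun _ _ => []) ρ

theorem update_hostStacks_inl (T : ∀ i k, List ((O i).tm.Γ k)) (ρ : Fin 3 → List Bool) (i : ι)
    (k : (O i).tm.K) (l : List ((O i).tm.Γ k)) :
    Function.update (hostStacks T ρ) (.inl ⟨i, k⟩) l =
      hostStacks (Function.update T i (Function.update (T i) k l)) ρ := by
  funext j
  rcases j with ⟨i', k'⟩ | j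
  · by_cases hi : i' = i
    · subst hi
      by_cases hk : k' = k
      · subst hk; simp [hostStacks]
      · rw [Function.update_of_ne (by simpa using hk)]; simp [hostStacks, hk]
    · rw [Function.update_of_ne (by simp [hi])]; simp [hostStacks, hi]
  · rw [Function.update_of_ne Sum.inr_ne_inl]; rfl

theorem update_hostStacks_inr (T : ∀ i k, List ((O i).tm.Γ k)) (ρ : Fin 3 → List Bool) (j : Fin 3)
    (l : List Bool) :
    Function.update (hostStacks T ρ) (.inr j) l = hostStacks T (Function.update ρ j l) := by
  funext k
  rcases k with p | j'
  · rw [Function.update_of_ne Sum.inl_ne_inr]; rfl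
  · by_cases h : j' = j
    · subst h; simp [hostStacks]
    · rw [Function.update_of_ne (by simpa using h)]; simp [hostStacks, h]

/-- A statement of the machine `O i`, to be executed by a machine with the subroutines `O`. -/
def liftStmt (i : ι) {Λ : Type} :
    TM2.Stmt (O i).tm.Γ Λ (O i).tm.σ → TM2.Stmt (HostΓ O) Λ (HostState O × Option Bool)
  | .push k f q => .push (.inl ⟨i, k⟩) (fun v => f (v.1 i)) (liftStmt i q)
  | .peek k f q =>
    .peek (.inl ⟨i, k⟩) (fun v o => (Function.update v.1 i (f (v.1 i) o), v.2)) (liftStmt i q)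
  | .pop k f q =>
    .pop (.inl ⟨i, k⟩) (fun v o => (Function.update v.1 i (f (v.1 i) o), v.2)) (liftStmt i q)
  | .load f q => .load (fun v => (Function.update v.1 i (f (v.1 i)), v.2)) (liftStmt i q)
  | .branch f q₁ q₂ => .branch (fun v => f (v.1 i)) (liftStmt i q₁) (liftStmt i q₂)
  | .goto l => .goto fun v => l (v.1 i)
  | .halt => .load (fun v => (v.1, none)) .halt

/-- The configuration of a machine that executes the subroutine `O i`. -/
def liftCfg (i : ι) (w : HostState O) (o : Option Bool) (T : ∀ i k, List ((O i).tm.Γ k))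
    (ρ : Fin 3 → List Bool) {Λ : Type} (c : TM2.Cfg (O i).tm.Γ Λ (O i).tm.σ) :
    TM2.Cfg (HostΓ O) Λ (HostState O × Option Bool) :=
  ⟨c.l, (Function.update w i c.var, c.l.elim none fun _ => o),
    hostStacks (Function.update T i c.stk) ρ⟩

theorem stepAux_liftStmt (i : ι) (w : HostState O) (o : Option Bool)
    (T : ∀ i k, List ((O i).tm.Γ k)) (ρ : Fin 3 → List Bool) {Λ : Type}
    (q : TM2.Stmt (O i).tm.Γ Λ (O i).tm.σ) (v : (O i).tm.σ) (S : ∀ k, List ((O i).tm.Γ k)) :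
    TM2.stepAux (liftStmt i q) (Function.update w i v, o) (hostStacks (Function.update T i S) ρ) =
      liftCfg i w o T ρ (TM2.stepAux q v S) := by
  induction q generalizing v S with
  | push k f q ih =>
    simp only [liftStmt, TM2.stepAux, ← ih, update_hostStacks_inl]
    simp [hostStacks]
  | peek k f q ih =>
    simp only [liftStmt, TM2.stepAux, ← ih]
    simp [hostStacks]
  | pop k f q ih =>
    simp only [liftStmt, TM2.stepAux, ← ih, update_hostStacks_inl]
    simp [hostStacks]
  | load f q ih => simp [liftStmt, ← ih]
  | branch f q₁ q₂ ih₁ ih₂ => cases h : f v <;> simp [liftStmt, h, ih₁, ih₂]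
  | goto l => simp [liftStmt, liftCfg]
  | halt => rfl

namespace Routine

variable {o : Option Bool} {t : ℕ}

/-- Execute the subroutine `O i`. -/
def call (i : ι) : Routine (HostΓ O) (HostState O) where
  Λ := (O i).tm.Λ
  fin := (O i).tm.ΛFin
  main := (O i).tm.main
  code l := liftStmt i ((O i).tm.m l)

theorem call_runs {i : ι} {l l' : List Bool} (h : OutputsWithin (O i) t l l')
    (ρ : Fin 3 → List Bool) :
    (call i).Runs (idleState O) o t
      (Function.update (regStacks ρ) (.inl ⟨i, (O i).tm.k₀⟩) (l.map (O i).inputAlphabet.symm))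
      (Function.update (regStacks ρ) (.inl ⟨i, (O i).tm.k₁⟩)
        (l'.map (O i).outputAlphabet.symm)) := by
  have := h.map (M' := (call i).code) (φ := liftCfg i (idleState O) o (fun _ _ => []) ρ)
    fun l v S => .single (stepAux_liftStmt i _ _ _ _ _ v S)
  rw [update_hostStacks_inl, update_hostStacks_inl]
  have hidle : Function.update (idleState O) i (O i).tm.initialState = idleState O :=
    Function.update_eq_self i _
  unfold liftCfg soloStack at this
  rwa [hidle] at this

/-- Apply the subroutine `O i` to the content of the register `r`. -/
def apply (i : ι) (r : Fin 3) : Routine (HostΓ O) (HostState O) :=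
  ((transfer (.inr r) (.refl Bool) (.inr 2) (.refl Bool) (.inl ⟨i, (O i).tm.k₀⟩)
    (O i).inputAlphabet).seq (call i)).seq
  (transfer (.inl ⟨i, (O i).tm.k₁⟩) (O i).outputAlphabet (.inr 2) (.refl Bool) (.inr r)
    (.refl Bool))

theorem apply_runs {i : ι} {r : Fin 3} (hr : r ≠ 2) {ρ : Fin 3 → List Bool} (hρ : ρ 2 = [])
    {l l' : List Bool} (h : OutputsWithin (O i) t l l') (hl : ρ r = l) :
    (apply i r).Runs (idleState O) o (t + 4 * (l.length + l'.length + 1)) (regStacks ρ)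
      (regStacks (Function.update ρ r l')) := by
  have hfree : regStacks (O := O) (Function.update ρ r []) (.inr 2) = [] := by
    simp [hostStacks, hr.symm, hρ]
  have hbase : regStacks (O := O) (Function.update ρ r []) (.inr r) = [] := by
    simp [hostStacks]
  have henter := transfer_runs (Γ := HostΓ O) (w := idleState O) (o := o)
    (k' := .inl ⟨i, (O i).tm.k₀⟩) (by simpa using hr) Sum.inr_ne_inl
    (.refl Bool) (.refl Bool) (O i).inputAlphabet l hbase hfree
  have hleave := transfer_runs (Γ := HostΓ O) (w := idleState O) (o := none)
    (k := .inl ⟨i, (O i).tm.k₁⟩) (k' := .inr r) Sum.inl_ne_inr (by simpa using hr.symm)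
    (O i).outputAlphabet (.refl Bool) (.refl Bool) l' rfl hfree
  have hinput : regStacks (Function.update ρ r []) (.inl ⟨i, (O i).tm.k₀⟩) = [] := rfl
  rw [hinput, List.append_nil, update_hostStacks_inr] at henter
  rw [hbase, List.append_nil, update_hostStacks_inr] at hleave
  have := ((henter.seq (call_runs h (Function.update ρ r []))).seq hleave).mono
    (t' := t + 4 * (l.length + l'.length + 1)) (by omega)
  subst hl
  rw [apply]
  simpa using this

end Routine

theorem update_triple_zero (a b c l : List Bool) : Function.update ![a, b, c] 0 l = ![l, b, c] := by
  funext j; fin_cases j <;> rfl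

theorem update_triple_one (a b c l : List Bool) : Function.update ![a, b, c] 1 l = ![a, l, c] := by
  funext j; fin_cases j <;> rfl

theorem update_triple_two (a b c l : List Bool) : Function.update ![a, b, c] 2 l = ![a, b, l] := by
  funext j; fin_cases j <;> rfl

namespace Routine

variable {o : Option Bool}

/-- Push the letter in the register onto the stacks `0` and `1`. -/
def putTwice : Routine (HostΓ O) (HostState O) :=
  single <| .push (.inr 0) (fun v => v.2.getD false) <| .push (.inr 1) (fun v => v.2.getD false) <|
    .load (fun v => (v.1, none)) .halt

/-- Copy the content of the register `0` to the register `1`. -/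
def copy : Routine (HostΓ O) (HostState O) :=
  (move (.inr 0) (.refl Bool) (.inr 2) (.refl Bool)).seq <|
    forEach (.inr 2) (.refl Bool) putTwice

theorem copy_runs (w : HostState O) (l : List Bool) :
    (copy (O := O)).Runs w o (4 * l.length + 2) (regStacks ![l, [], []])
      (regStacks ![l, l, []]) := by
  have hmove := move_runs (Γ := HostΓ O) (w := w) (o := o) (S := regStacks ![[], [], []])
    (k := .inr 0) (k' := .inr 2) (by simp) (.refl Bool) (.refl Bool) l rfl
  have hput := forEach_runs (Γ := HostΓ O) (w := w) (t := 1) (k := .inr 2) (e := .refl Bool)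
    (R := putTwice) (fun d => regStacks ![d, d, []]) l.reverse [] (fun d b l' _ => .single (by
      simp [putTwice, single, update_hostStacks_inr, update_triple_zero, update_triple_one,
        update_triple_two, hostStacks])) none
  have hscratch : regStacks (O := O) ![[], [], []] (.inr 2) = [] := rfl
  simp only [hscratch, update_hostStacks_inr, update_triple_zero, update_triple_two,
    Equiv.refl_symm, Equiv.coe_refl, List.map_id, List.append_nil, List.reverse_reverse]
    at hmove hput
  exact (hmove.seq hput).mono (by rw [List.length_reverse]; omega)

end Routine

namespace Routine

/-- The machine that executes a routine, with input and output in the register `0`. -/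
def machine [Finite ι] (R : Routine (HostΓ O) (HostState O)) : TM2ComputableAux Bool Bool where
  tm :=
    { K := HostK O
      kFin := by have := fun i => (O i).tm.kFin; have := Fintype.ofFinite ι; infer_instance
      k₀ := .inr 0
      k₁ := .inr 0
      Γ := HostΓ O
      Λ := R.Λ
      main := R.main
      ΛFin := R.fin
      σ := HostState O × Option Bool
      initialState := (idleState O, none)
      σFin := by have := fun i => (O i).tm.σFin; have := Fintype.ofFinite ι; infer_instance
      Γk₀Fin := inferInstanceAs (Fintype Bool)
      m := R.code }
  inputAlphabet := .refl Bool
  outputAlphabet := .refl Bool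

theorem machine_outputsWithin [Finite ι] {R : Routine (HostΓ O) (HostState O)} {t : ℕ}
    {l l' : List Bool}
    (h : R.Runs (idleState O) none t (regStacks ![l, [], []]) (regStacks ![l', [], []])) :
    OutputsWithin R.machine t l l' := by
  have hsolo (l : List Bool) : soloStack (Γ := HostΓ O) (.inr 0) (.refl Bool) l =
      regStacks ![l, [], []] := by
    have hempty : (fun _ => [] : ∀ k, List (HostΓ O k)) = regStacks ![[], [], []] := by
      funext k
      rcases k with p | j
      · rfl
      · fin_cases j <;> rfl
    rw [soloStack, hempty, update_hostStacks_inr, update_triple_zero]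
    exact congrArg (fun l => regStacks ![l, [], []]) (List.map_id l)
  rw [← hsolo, ← hsolo] at h
  exact h

end Routine

section PolyRuns

variable {α : Type} {x y z b : α → List Bool} {ρ ρ' ρ'' : α → Fin 3 → List Bool}

namespace Routine

/-- Executed when no subroutine is running, the routine changes the contents of the registers from
`ρ a` to `ρ' a`, in time polynomial in the length of `x a`. -/
def PolyRuns (R : Routine (HostΓ O) (HostState O)) (x : α → List Bool)
    (ρ ρ' : α → Fin 3 → List Bool) : Prop :=
  ∃ g, PolyBounded x g ∧
    ∀ a o, R.Runs (idleState O) o (g a) (regStacks (ρ a)) (regStacks (ρ' a))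

theorem PolyRuns.seq {R R' : Routine (HostΓ O) (HostState O)} (h : R.PolyRuns x ρ ρ')
    (h' : R'.PolyRuns x ρ' ρ'') : (R.seq R').PolyRuns x ρ ρ'' := by
  obtain ⟨g, hg, h⟩ := h
  obtain ⟨g', hg', h'⟩ := h'
  exact ⟨_, hg.add hg', fun a o => (h a o).seq (h' a none)⟩

theorem PolyRuns.computes [Finite ι] {R : Routine (HostΓ O) (HostState O)}
    (h : R.PolyRuns x (fun a => ![x a, [], []]) fun a => ![y a, [], []]) : Computes x y := by
  obtain ⟨g, ⟨p, hp⟩, h⟩ := h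
  exact computes_iff_exists_computedBy.2
    ⟨R.machine, p, fun a => machine_outputsWithin ((h a none).mono (hp a))⟩

theorem apply_polyRuns {i : ι} {r : Fin 3} (hr : r ≠ 2) (h : ComputedBy (O i) y z)
    (hy : PolyBounded x fun a => (y a).length) (hρ : ∀ a, ρ a 2 = []) (hρr : ∀ a, ρ a r = y a) :
    (apply (O := O) i r).PolyRuns x ρ fun a => Function.update (ρ a) r (z a) := by
  have hz := h.polyBounded.trans hy
  obtain ⟨p, h⟩ := h
  exact ⟨_, (hy.eval p).add ((PolyBounded.const 4).mul ((hy.add hz).add (.const 1))),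
    fun a o => apply_runs hr (hρ a) (h a) (hρr a)⟩

theorem apply_zero_polyRuns {i : ι} (h : ComputedBy (O i) y z)
    (hy : PolyBounded x fun a => (y a).length) :
    (apply (O := O) i 0).PolyRuns x (fun a => ![y a, b a, []]) fun a => ![z a, b a, []] := by
  simpa only [update_triple_zero] using
    apply_polyRuns (r := 0) (ρ := fun a => ![y a, b a, []]) (by decide) h hy (fun _ => rfl)
      fun _ => rfl

theorem apply_one_polyRuns {i : ι} (h : ComputedBy (O i) y z)
    (hy : PolyBounded x fun a => (y a).length) :
    (apply (O := O) i 1).PolyRuns x (fun a => ![b a, y a, []]) fun a => ![b a, z a, []] := by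
  simpa only [update_triple_one] using
    apply_polyRuns (r := 1) (ρ := fun a => ![b a, y a, []]) (by decide) h hy (fun _ => rfl)
      fun _ => rfl

theorem copy_polyRuns :
    (copy (O := O)).PolyRuns x (fun a => ![x a, [], []]) fun a => ![x a, x a, []] :=
  ⟨_, ((PolyBounded.const 4).mul .length).add (.const 2), fun a _ => copy_runs _ (x a)⟩

theorem transfer_polyRuns (hy : PolyBounded x fun a => (y a).length) :
    (transfer (Γ := HostΓ O) (.inr 1) (.refl Bool) (.inr 2) (.refl Bool) (.inr 0)
      (.refl Bool)).PolyRuns x (fun a => ![z a, y a, []]) fun a => ![y a ++ z a, [], []] := by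
  refine ⟨_, ((PolyBounded.const 4).mul hy).add (.const 2), fun a o => ?_⟩
  have h := transfer_runs (Γ := HostΓ O) (w := idleState O) (o := o)
    (S := regStacks ![z a, [], []]) (k := .inr 1) (s := .inr 2) (k' := .inr 0) (by simp) (by simp)
    (.refl Bool) (.refl Bool) (.refl Bool) (y a) rfl rfl
  rw [update_hostStacks_inr, update_hostStacks_inr, update_triple_one, update_triple_zero] at h
  simpa [hostStacks] using h

theorem forEach_apply_polyRuns {β : Type} {v : β → List Bool} {F : β → β} {I : α → β} {N : α → ℕ}
    {i : ι} (hF : ComputedBy (O i) v fun b => v (F b)) {g : α → ℕ} (hN : PolyBounded x N)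
    (hg : PolyBounded x g) (hlen : ∀ a, ∀ n ≤ N a, (v (F^[n] (I a))).length ≤ g a) :
    (forEach (.inr 1) (.refl Bool) (apply (O := O) i 0)).PolyRuns x
      (fun a => ![v (I a), encodeUnary (N a), []]) fun a => ![v (F^[N a] (I a)), [], []] := by
  obtain ⟨p, hF⟩ := hF
  refine ⟨_, ((hN.mul (((hg.eval p).add ((PolyBounded.const 4).mul
    ((hg.add hg).add (.const 1)))).add (.const 1))).add (.const 1)), fun a o => ?_⟩
  have h := forEach_runs (Γ := HostΓ O) (w := idleState O) (k := .inr 1) (e := .refl Bool)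
    (R := apply i 0) (t := p.eval (g a) + 4 * (g a + g a + 1))
    (fun d => regStacks ![v (F^[d.length] (I a)), [], []]) (encodeUnary (N a)) [] ?_ o
  · simpa [encodeUnary, update_hostStacks_inr, update_triple_one] using h
  · intro d b l' hd
    have hlt : d.length.succ ≤ N a := by
      have := congrArg List.length hd
      simp only [encodeUnary, List.reverse_nil, List.nil_append, List.length_append,
        List.length_reverse, List.length_cons, List.length_replicate] at this
      omega
    have houtput := hF (F^[d.length] (I a))
    dsimp only at houtput
    rw [← Function.iterate_succ_apply' F] at houtput
    have hrun := apply_runs (ρ := ![v (F^[d.length] (I a)), l', []]) (r := 0) (o := some b)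
      (by decide) rfl houtput rfl
    rw [update_triple_zero] at hrun
    have htime := monotone_eval p (hlen a _ (Nat.le_of_succ_le hlt))
    have hin := hlen a _ (Nat.le_of_succ_le hlt)
    have hout := hlen a _ hlt
    dsimp only at htime
    simpa [update_hostStacks_inr, update_triple_one] using hrun.mono (by omega)

end Routine

end PolyRuns

end Host

namespace Computes

open Routine

variable {α : Type} {x y z : α → List Bool}

theorem trans (hy : Computes x y) (hz : Computes y z) : Computes x z := by
  obtain ⟨A, hA⟩ := computes_iff_exists_computedBy.1 hy
  obtain ⟨B, hB⟩ := computes_iff_exists_computedBy.1 hz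
  exact ((apply_zero_polyRuns (O := ![A, B]) (i := 0) hA .length).seq
    (apply_zero_polyRuns (i := 1) hB hA.polyBounded)).computes

theorem append (hy : Computes x y) (hz : Computes x z) : Computes x (fun a => y a ++ z a) := by
  obtain ⟨A, hA⟩ := computes_iff_exists_computedBy.1 hy
  obtain ⟨B, hB⟩ := computes_iff_exists_computedBy.1 hz
  exact (((copy_polyRuns (O := ![A, B]).seq (apply_one_polyRuns (i := 0) hA .length)).seq
    (apply_zero_polyRuns (i := 1) hB .length)).seq (transfer_polyRuns hA.polyBounded)).computes

theorem iterate {β : Type} {v : β → List Bool} {F : β → β} {I : α → β} {N : α → ℕ}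
    (hN : Computes x fun a => encodeUnary (N a)) (hI : Computes x fun a => v (I a))
    (hF : Computes v fun b => v (F b)) {g : α → ℕ} (hg : PolyBounded x g)
    (hlen : ∀ a, ∀ n ≤ N a, (v (F^[n] (I a))).length ≤ g a) :
    Computes x fun a => v (F^[N a] (I a)) := by
  obtain ⟨A, hA⟩ := computes_iff_exists_computedBy.1 hN
  obtain ⟨B, hB⟩ := computes_iff_exists_computedBy.1 hI
  obtain ⟨C, hC⟩ := computes_iff_exists_computedBy.1 hF
  have hN' : PolyBounded x N := by simpa [encodeUnary] using hA.polyBounded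
  exact (((copy_polyRuns (O := ![A, B, C]).seq (apply_one_polyRuns (i := 0) hA .length)).seq
    (apply_zero_polyRuns (i := 1) hB .length)).seq
    (forEach_apply_polyRuns (i := 2) hC hN' hg hlen)).computes

end Computes

end Machines

/-! ### Polynomial-time functions of words and binary numbers -/

section Words

variable {α : Type} {x y z : α → List Bool} {c d e : α → Bool}

/-- A transducer that ignores its input. -/
def constTransducer (w : List Bool) : Transducer where
  Q := Unit
  start := ()
  next _ _ := ()
  emit _ _ := []
  final _ := w
  width := w.length
  emit_le := by simp
  final_le := by simp

/-- A transducer that treats the first letter in a special way. -/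
def headTransducer (w : List Bool) (f g : Bool → List Bool) : Transducer where
  Q := Bool
  start := true
  next _ _ := false
  emit q b := if q then f b else g b
  final q := if q then w else []
  width := (f true).length + (f false).length + (g true).length + (g false).length + w.length
  emit_le := by rintro (_ | _) (_ | _) <;> simp <;> omega
  final_le := by rintro (_ | _) <;> simp

theorem headTransducer_out_false (w l : List Bool) (f g : Bool → List Bool) :
    (headTransducer w f g).out false l = l.flatMap g := by
  induction l with
  | nil => rfl
  | cons b l ih => simpa [Transducer.out, headTransducer] using ih

/-- An injective encoding of pairs of words: every letter of the first word is preceded by the flag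
`true`, and the second word by the flag `false`. -/
def pairWord (l l' : List Bool) : List Bool :=
  l.flatMap (fun b => [true, b]) ++ false :: l'

theorem length_pairWord (l l' : List Bool) :
    (pairWord l l').length = 2 * l.length + l'.length + 1 := by
  simp [pairWord, List.length_flatMap]
  omega

/-- A transducer that reads a bit followed by a pair, and writes the first component of the pair if
the bit is `true`, the second one if it is `false`. After the bit `b`, it expects a flag in the
state `some (b, none)`; the last flag read is recorded in the other states `some (b, some c)`. -/
def selectTransducer : Transducer where
  Q := Option (Bool × Option Bool)
  start := none
  next
    | none, b => some (b, none)
    | some (b, none), flag => some (b, some flag)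
    | some (b, some true), _ => some (b, none)
    | some (b, some false), _ => some (b, some false)
  emit
    | some (b, some flag), letter => if b = flag then [letter] else []
    | _, _ => []
  final _ := []
  width := 1
  emit_le := by rintro (_ | ⟨_ | _, _ | _ | _⟩) _ <;> simp
  final_le := by simp

theorem selectTransducer_out_snd (b : Bool) (l : List Bool) :
    selectTransducer.out (some (b, some false)) l = if b then [] else l := by
  induction l with
  | nil => simp [Transducer.out, selectTransducer]
  | cons a l ih =>
    change (if b = false then [a] else []) ++ selectTransducer.out (some (b, some false)) l = _
    cases b <;> simp [ih]

theorem selectTransducer_out (b : Bool) (l l' : List Bool) :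
    selectTransducer.out selectTransducer.start (b :: pairWord l l') = if b then l else l' := by
  change selectTransducer.out (some (b, none)) (pairWord l l') = _
  induction l with
  | nil => exact selectTransducer_out_snd b l'
  | cons a l ih =>
    change (if b = true then [a] else []) ++ selectTransducer.out (some (b, none)) (pairWord l l') =
      _
    rw [ih]
    cases b <;> simp

namespace Computes

theorem transduce (T : Transducer) (h : Computes x y) :
    Computes x (fun a => T.out T.start (y a)) :=
  h.trans (T.computes y)

theorem const (w : List Bool) : Computes x (fun _ => w) :=
  ((refl x).transduce (constTransducer w)).of_eq (fun _ => rfl) fun a => by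
    induction x a with
    | nil => rfl
    | cons b l ih => simpa [Transducer.out, constTransducer] using ih

theorem modifyHead (h : Computes x y) (w : List Bool) (f g : Bool → List Bool) :
    Computes x (fun a => (y a).casesOn w fun b l => f b ++ l.flatMap g) :=
  (h.transduce (headTransducer w f g)).of_eq (fun _ => rfl) fun a => by
    cases y a with
    | nil => rfl
    | cons b l => exact (congrArg (f b ++ ·) (headTransducer_out_false w l f g)).symm

theorem flatMap (h : Computes x y) (f : Bool → List Bool) :
    Computes x (fun a => (y a).flatMap f) :=
  (h.modifyHead [] f f).of_eq (fun _ => rfl) fun a => by cases y a <;> rfl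

theorem cons (h : Computes x y) (b : Bool) : Computes x (fun a => b :: y a) :=
  (const [b]).append h

theorem tail (h : Computes x y) : Computes x (fun a => (y a).tail) :=
  (h.modifyHead [] (fun _ => []) fun b => [b]).of_eq (fun _ => rfl) fun a => by cases y a <;> simp

theorem headD (h : Computes x y) : Computes x (fun a => [(y a).headD false]) :=
  (h.modifyHead [false] (fun b => [b]) fun _ => []).of_eq (fun _ => rfl) fun a => by
    cases y a <;> simp

theorem isEmpty (h : Computes x y) : Computes x (fun a => [(y a).isEmpty]) :=
  (h.modifyHead [true] (fun _ => [false]) fun _ => []).of_eq (fun _ => rfl) fun a => by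
    cases y a <;> simp

theorem length (h : Computes x y) : Computes x (fun a => encodeUnary (y a).length) :=
  (h.flatMap fun _ => [true]).of_eq (fun _ => rfl) fun _ => by simp [encodeUnary, List.flatMap]

theorem pair (hy : Computes x y) (hz : Computes x z) :
    Computes x (fun a => pairWord (y a) (z a)) :=
  (hy.flatMap fun b => [true, b]).append (hz.cons false)

theorem fst (h : Computes x (fun a => pairWord (y a) (z a))) : Computes x y :=
  ((h.cons true).transduce selectTransducer).of_eq (fun _ => rfl) fun a => by
    rw [selectTransducer_out, if_pos rfl]

theorem snd (h : Computes x (fun a => pairWord (y a) (z a))) : Computes x z :=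
  ((h.cons false).transduce selectTransducer).of_eq (fun _ => rfl) fun a => by
    rw [selectTransducer_out, if_neg Bool.false_ne_true]

theorem ite (hc : Computes x (fun a => [c a])) (hy : Computes x y) (hz : Computes x z) :
    Computes x (fun a => if c a then y a else z a) :=
  ((hc.append (hy.pair hz)).transduce selectTransducer).of_eq (fun _ => rfl) fun _ =>
    (selectTransducer_out _ _ _).symm

theorem bit (f : Bool → Bool) (hc : Computes x (fun a => [c a])) :
    Computes x (fun a => [f (c a)]) :=
  (hc.flatMap fun b => [f b]).of_eq (fun _ => rfl) fun _ => by simp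

theorem bit₂ (f : Bool → Bool → Bool) (hc : Computes x (fun a => [c a]))
    (hd : Computes x (fun a => [d a])) : Computes x (fun a => [f (c a) (d a)]) :=
  (hc.ite (hd.bit (f true)) (hd.bit (f false))).of_eq (fun _ => rfl) fun a => by
    cases c a <;> rfl

theorem bit₃ (f : Bool → Bool → Bool → Bool) (hc : Computes x (fun a => [c a]))
    (hd : Computes x (fun a => [d a])) (he : Computes x (fun a => [e a])) :
    Computes x (fun a => [f (c a) (d a) (e a)]) :=
  (hc.ite (hd.bit₂ (f true) he) (hd.bit₂ (f false) he)).of_eq (fun _ => rfl) fun a => by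
    cases c a <;> rfl

theorem recurrence {N : α → ℕ} {w : α → ℕ → List Bool} {g : α → ℕ}
    (hN : Computes x (fun a => encodeUnary (N a))) (hzero : Computes x (fun a => w a 0))
    (hsucc : Computes
      (fun p : α × ℕ => pairWord (x p.1) (pairWord (encodeUnary p.2) (w p.1 p.2)))
      (fun p => w p.1 (p.2 + 1)))
    (hg : PolyBounded x g) (hlen : ∀ a, ∀ i ≤ N a, (w a i).length ≤ g a) :
    Computes x (fun a => w a (N a)) := by
  have hiter (a : α) (n : ℕ) : (fun p : α × ℕ => (p.1, p.2 + 1))^[n] (a, 0) = (a, n) := by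
    induction n with
    | zero => rfl
    | succ n ih => rw [Function.iterate_succ_apply', ih]
  have hstate := Computes.refl
    fun p : α × ℕ => pairWord (x p.1) (pairWord (encodeUnary p.2) (w p.1 p.2))
  have hbound : PolyBounded x fun a => 2 * (x a).length + (2 * N a + g a + 1) + 1 := by
    have hN' : PolyBounded x N := by simpa [encodeUnary] using hN.polyBounded
    exact ((((PolyBounded.const 2).mul .length).add
      ((((PolyBounded.const 2).mul hN').add hg).add (.const 1))).add (.const 1))
  have h := hN.iterate (F := fun p : α × ℕ => (p.1, p.2 + 1)) (I := fun a => (a, 0))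
    ((refl x).pair ((const []).pair hzero))
    (hstate.fst.pair ((hstate.snd.fst.cons true).pair hsucc)) hbound fun a n hn => by
      have := hlen a n hn
      simp only [hiter, length_pairWord, encodeUnary, List.length_replicate]
      omega
  simp only [hiter] at h
  exact h.snd.snd

end Computes

end Words

section Binary

open Computability (encodeNat encodeNum encodePosNum)

theorem encodeNat_eq_bits (n : ℕ) : encodeNat n = n.bits := by
  induction n using Nat.binaryRec' with
  | zero => simp [encodeNat, encodeNum]
  | bit b n h ih =>
    rw [Nat.bits_append_bit _ _ h, ← ih, encodeNat, encodeNat, ← Num.ofNat'_eq, ← Num.ofNat'_eq,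
      Num.ofNat'_bit]
    cases hn : Num.ofNat' n with
    | zero =>
      have hzero : n = 0 := by
        simpa [Num.ofNat'_eq] using congrArg (fun m : Num => (m : ℕ)) hn
      rw [h hzero]
      rfl
    | pos p => cases b <;> rfl

theorem length_encodeNat (n : ℕ) : (encodeNat n).length = n.size := by
  rw [encodeNat_eq_bits, Nat.size_eq_bits_len]

theorem isEmpty_encodeNat (n : ℕ) : (encodeNat n).isEmpty = decide (n = 0) := by
  rw [Bool.eq_iff_iff, List.isEmpty_iff_length_eq_zero, length_encodeNat, Nat.size_eq_zero]
  simp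

theorem encodeNat_double_add_one (n : ℕ) : encodeNat (2 * n + 1) = true :: encodeNat n := by
  rw [encodeNat_eq_bits, encodeNat_eq_bits, Nat.bit1_bits]

theorem encodeNat_double (n : ℕ) : encodeNat (2 * n) =
    (encodeNat n).casesOn [] fun b l => [false, b] ++ l.flatMap fun b => [b] := by
  rcases eq_or_ne n 0 with rfl | hn
  · rfl
  · rw [encodeNat_eq_bits, encodeNat_eq_bits, Nat.bit0_bits _ hn]
    cases h : n.bits with
    | nil => exact absurd (by rw [← Nat.size_eq_bits_len, h]; rfl) (mt Nat.size_eq_zero.1 hn)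
    | cons b l => simp

theorem tail_encodeNat (n : ℕ) : (encodeNat n).tail = encodeNat (n / 2) := by
  rw [encodeNat_eq_bits, encodeNat_eq_bits, ← Nat.div2_val]
  exact (Nat.div2_bits_eq_tail n).symm

theorem headD_encodeNat (n : ℕ) : (encodeNat n).headD false = n.testBit 0 := by
  rw [encodeNat_eq_bits, Nat.testBit_zero, Nat.mod_two_of_bodd, Nat.bodd_eq_bits_head]
  cases n.bits with
  | nil => rfl
  | cons b l => cases b <;> rfl

theorem size_div_le (m k : ℕ) : (m / k).size ≤ m.size :=
  Nat.size_le_size (Nat.div_le_self _ _)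

theorem size_mul_le (m n : ℕ) : (m * n).size ≤ m.size + n.size := by
  rw [Nat.size_le, pow_add]
  exact Nat.mul_lt_mul'' (Nat.lt_size_self m) (Nat.lt_size_self n)

/-- The number with the binary digits `b 0, …, b (i - 1)`, most significant digit first, by Horner's
scheme. -/
def ofDigits (b : ℕ → Bool) : ℕ → ℕ
  | 0 => 0
  | i + 1 => 2 * ofDigits b i + (b i).toNat

theorem ofDigits_testBit {n N : ℕ} (hn : n < 2 ^ N) {b : ℕ → Bool}
    (hb : ∀ i < N, n.testBit i = b i) {i : ℕ} (hi : i ≤ N) :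
    ofDigits (fun j => b (N - 1 - j)) i = n / 2 ^ (N - i) := by
  induction i with
  | zero => simp [ofDigits, Nat.div_eq_of_lt hn]
  | succ i ih =>
    rw [ofDigits, ih (by omega), ← hb _ (by omega), show N - i = N - 1 - i + 1 by omega,
      show N - (i + 1) = N - 1 - i by omega, pow_succ, ← Nat.div_div_eq_div_mul,
      Nat.toNat_testBit]
    exact Nat.div_add_mod _ 2

theorem mod_two_pow_succ (n i : ℕ) : n % 2 ^ (i + 1) = n % 2 ^ i + 2 ^ i * (n.testBit i).toNat := by
  rw [Nat.mod_pow_succ, Nat.toNat_testBit]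

theorem sum_ite_testBit (m n k : ℕ) :
    (∑ i ∈ Finset.range k, if n.testBit i then m * 2 ^ i else 0) = m * (n % 2 ^ k) := by
  induction k with
  | zero => simp [Nat.mod_one]
  | succ k ih =>
    rw [Finset.sum_range_succ, ih, mod_two_pow_succ, mul_add]
    cases n.testBit k <;> simp

/-- The carry into the binary digit `i` of `m + n`. -/
def carry (m n i : ℕ) : Bool :=
  decide (2 ^ i ≤ m % 2 ^ i + n % 2 ^ i)

theorem carry_succ (m n i : ℕ) :
    carry m n (i + 1) = Bool.atLeastTwo (m.testBit i) (n.testBit i) (carry m n i) := by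
  have hm : m % 2 ^ i < 2 ^ i := Nat.mod_lt _ (by positivity)
  have hn : n % 2 ^ i < 2 ^ i := Nat.mod_lt _ (by positivity)
  simp only [carry, mod_two_pow_succ]
  rw [pow_succ]
  cases m.testBit i <;> cases n.testBit i <;> simp [Bool.atLeastTwo] <;> omega

theorem testBit_add_eq_xor_carry (m n i : ℕ) :
    (m + n).testBit i = (m.testBit i ^^ n.testBit i ^^ carry m n i) := by
  simp only [Nat.testBit_eq_decide_div_mod_eq, Nat.add_div (Nat.two_pow_pos i), carry]
  split_ifs with h <;> rcases Nat.mod_two_eq_zero_or_one (m / 2 ^ i) with hm | hm <;>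
    rcases Nat.mod_two_eq_zero_or_one (n / 2 ^ i) with hn | hn <;>
    simp [Nat.add_mod, hm, hn, h]

section Arithmetic

variable {α : Type} {x y : α → List Bool} {m n N : α → ℕ} {b : α → ℕ → Bool} {c : α → Bool}

namespace Computes

theorem polyBounded_size (h : Computes x (fun a => encodeNat (n a))) :
    PolyBounded x (fun a => (n a).size) :=
  h.polyBounded.mono fun a => by rw [length_encodeNat]

theorem polyBounded_unary (h : Computes x (fun a => encodeUnary (N a))) : PolyBounded x N :=
  h.polyBounded.mono fun a => by simp [encodeUnary]

theorem constUnary (k : ℕ) : Computes x (fun _ => encodeUnary k) := const _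

theorem constNat (k : ℕ) : Computes x (fun _ => encodeNat k) := const _

theorem addUnary (hm : Computes x (fun a => encodeUnary (m a)))
    (hn : Computes x (fun a => encodeUnary (n a))) :
    Computes x (fun a => encodeUnary (m a + n a)) :=
  (hm.append hn).of_eq (fun _ => rfl) fun _ => List.replicate_add _ _ _

theorem constMulUnary (k : ℕ) (hn : Computes x (fun a => encodeUnary (n a))) :
    Computes x (fun a => encodeUnary (k * n a)) :=
  (hn.flatMap fun _ => List.replicate k true).of_eq (fun _ => rfl) fun a =>
    Eq.symm <| List.eq_replicate_iff.2
      ⟨by simp [encodeUnary, List.length_flatMap, mul_comm], by simp [encodeUnary]⟩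

theorem subUnary (hm : Computes x (fun a => encodeUnary (m a)))
    (hn : Computes x (fun a => encodeUnary (n a))) :
    Computes x (fun a => encodeUnary (m a - n a)) :=
  recurrence (w := fun a i => encodeUnary (m a - i)) hn hm
    ((refl _).snd.snd.tail.of_eq (fun _ => rfl) fun _ => by
      simp [encodeUnary, Nat.sub_add_eq])
    hm.polyBounded_unary fun _ _ _ => by simp [encodeUnary]

theorem size (h : Computes x (fun a => encodeNat (n a))) :
    Computes x (fun a => encodeUnary (n a).size) :=
  h.length.of_eq (fun _ => rfl) fun a => by rw [length_encodeNat]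

theorem half (h : Computes x (fun a => encodeNat (n a))) :
    Computes x (fun a => encodeNat (n a / 2)) :=
  h.tail.of_eq (fun _ => rfl) fun a => by rw [tail_encodeNat]

theorem eqZero (h : Computes x (fun a => encodeNat (n a))) :
    Computes x (fun a => [decide (n a = 0)]) :=
  h.isEmpty.of_eq (fun _ => rfl) fun a => by rw [isEmpty_encodeNat]

theorem double (h : Computes x (fun a => encodeNat (n a))) :
    Computes x (fun a => encodeNat (2 * n a)) :=
  (h.modifyHead [] (fun b => [false, b]) fun b => [b]).of_eq (fun _ => rfl) fun _ =>
    encodeNat_double _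

theorem doubleAddOne (h : Computes x (fun a => encodeNat (n a))) :
    Computes x (fun a => encodeNat (2 * n a + 1)) :=
  (h.cons true).of_eq (fun _ => rfl) fun a => by rw [encodeNat_double_add_one]

theorem iteNat (hc : Computes x (fun a => [c a])) (hm : Computes x (fun a => encodeNat (m a)))
    (hn : Computes x (fun a => encodeNat (n a))) :
    Computes x (fun a => encodeNat (if c a then m a else n a)) :=
  (hc.ite hm hn).of_eq (fun _ => rfl) fun a => by cases c a <;> rfl

theorem doubleAddBit (hn : Computes x (fun a => encodeNat (n a)))
    (hc : Computes x (fun a => [c a])) :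
    Computes x (fun a => encodeNat (2 * n a + (c a).toNat)) :=
  (hc.iteNat hn.doubleAddOne hn.double).of_eq (fun _ => rfl) fun a => by cases c a <;> rfl

theorem comp_fst (h : Computes x y) (w : α × ℕ → List Bool) :
    Computes (fun p : α × ℕ => pairWord (x p.1) (w p)) (fun p => y p.1) :=
  (refl _).fst.trans (h.comp Prod.fst)

theorem withState {v : α × ℕ → List Bool}
    (h : Computes (fun p : α × ℕ => pairWord (x p.1) (encodeUnary p.2)) v)
    (w : α × ℕ → List Bool) :
    Computes (fun p : α × ℕ => pairWord (x p.1) (pairWord (encodeUnary p.2) (w p))) v :=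
  ((refl _).fst.pair (refl _).snd.fst).trans h

theorem recurrenceNat {r : α → ℕ → ℕ} {g : α → ℕ}
    (hN : Computes x (fun a => encodeUnary (N a))) (hzero : Computes x (fun a => encodeNat (r a 0)))
    (hsucc : Computes
      (fun p : α × ℕ => pairWord (x p.1) (pairWord (encodeUnary p.2) (encodeNat (r p.1 p.2))))
      (fun p => encodeNat (r p.1 (p.2 + 1))))
    (hg : PolyBounded x g) (hsize : ∀ a, ∀ i ≤ N a, (r a i).size ≤ g a) :
    Computes x (fun a => encodeNat (r a (N a))) :=
  recurrence (w := fun a i => encodeNat (r a i)) hN hzero hsucc hg fun a i hi => by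
    rw [length_encodeNat]; exact hsize a i hi

theorem shiftRight (hn : Computes x (fun a => encodeNat (n a)))
    (hN : Computes x (fun a => encodeUnary (N a))) :
    Computes x (fun a => encodeNat (n a / 2 ^ N a)) :=
  recurrenceNat (r := fun a i => n a / 2 ^ i) hN (hn.of_eq (fun _ => rfl) fun a => by simp)
    ((refl _).snd.snd.half.of_eq (fun _ => rfl) fun p => by
      rw [pow_succ, Nat.div_div_eq_div_mul])
    hn.polyBounded_size fun _ _ _ => size_div_le _ _

theorem shiftLeft (hn : Computes x (fun a => encodeNat (n a)))
    (hN : Computes x (fun a => encodeUnary (N a))) :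
    Computes x (fun a => encodeNat (n a * 2 ^ N a)) :=
  recurrenceNat (r := fun a i => n a * 2 ^ i) hN (hn.of_eq (fun _ => rfl) fun a => by simp)
    ((refl _).snd.snd.double.of_eq (fun _ => rfl) fun p => by rw [pow_succ', mul_left_comm])
    ((hn.polyBounded_size.add hN.polyBounded_unary).add (.const 1)) fun a i hi => by
      have := size_mul_le (n a) (2 ^ i)
      rw [Nat.size_pow] at this
      omega

theorem twoPow (h : Computes x (fun a => encodeUnary (N a))) :
    Computes x (fun a => encodeNat (2 ^ N a)) :=
  ((constNat 1).shiftLeft h).of_eq (fun _ => rfl) fun _ => by rw [one_mul]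

theorem testBit (hn : Computes x (fun a => encodeNat (n a)))
    (hN : Computes x (fun a => encodeUnary (N a))) :
    Computes x (fun a => [(n a).testBit (N a)]) :=
  (hn.shiftRight hN).headD.of_eq (fun _ => rfl) fun a => by
    rw [headD_encodeNat, Nat.testBit_div_two_pow, Nat.zero_add]

theorem ofTestBit (hN : Computes x (fun a => encodeUnary (N a)))
    (hb : Computes (fun p : α × ℕ => pairWord (x p.1) (encodeUnary p.2)) (fun p => [b p.1 p.2]))
    (hlt : ∀ a, n a < 2 ^ N a) (hbit : ∀ a, ∀ i < N a, (n a).testBit i = b a i) :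
    Computes x (fun a => encodeNat (n a)) := by
  have hrev : Computes (fun p : α × ℕ => pairWord (x p.1) (encodeUnary p.2))
      (fun p => [b p.1 (N p.1 - 1 - p.2)]) :=
    ((refl _).fst.pair (((hN.comp_fst _).subUnary (constUnary 1)).subUnary
      (refl _).snd)).trans (hb.comp fun p : α × ℕ => (p.1, N p.1 - 1 - p.2))
  have hdigits (a : α) {i : ℕ} (hi : i ≤ N a) := ofDigits_testBit (hlt a) (hbit a) hi
  refine (recurrenceNat (r := fun a => ofDigits fun j => b a (N a - 1 - j)) hN (constNat 0)
    ((refl _).snd.snd.doubleAddBit (hrev.withState _))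
    hN.polyBounded_unary fun a i hi => ?_).of_eq (fun _ => rfl) fun a => ?_
  · rw [hdigits a hi]
    exact (size_div_le _ _).trans (Nat.size_le.2 (hlt a))
  · rw [hdigits a le_rfl, Nat.sub_self, pow_zero, Nat.div_one]

theorem carry (hm : Computes x (fun a => encodeNat (m a)))
    (hn : Computes x (fun a => encodeNat (n a))) (hN : Computes x (fun a => encodeUnary (N a))) :
    Computes x (fun a => [PeriodicHeat.carry (m a) (n a) (N a)]) :=
  recurrence (w := fun a i => [PeriodicHeat.carry (m a) (n a) i]) hN
    ((const [false]).of_eq (fun _ => rfl) fun a => by simp [PeriodicHeat.carry, Nat.mod_one])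
    (((hm.comp_fst _).testBit (refl _).snd.fst).bit₃ Bool.atLeastTwo
      ((hn.comp_fst _).testBit (refl _).snd.fst)
      (e := fun p : α × ℕ => PeriodicHeat.carry (m p.1) (n p.1) p.2)
      (refl _).snd.snd |>.of_eq (fun _ => rfl) fun _ => by rw [carry_succ])
    (.const 1) fun _ _ _ => le_rfl

theorem add (hm : Computes x (fun a => encodeNat (m a)))
    (hn : Computes x (fun a => encodeNat (n a))) :
    Computes x (fun a => encodeNat (m a + n a)) := by
  refine ofTestBit ((hm.size.addUnary hn.size).addUnary (constUnary 1))
    (((hm.comp_fst _).testBit (refl _).snd).bit₃ (fun b c d => b ^^ c ^^ d)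
      ((hn.comp_fst _).testBit (refl _).snd)
      ((hm.comp_fst _).carry (hn.comp_fst _) (refl _).snd))
    (fun a => ?_) fun a i _ => testBit_add_eq_xor_carry _ _ _
  rw [pow_succ, mul_two]
  exact add_lt_add
    ((Nat.lt_size_self _).trans_le (Nat.pow_le_pow_right two_pos (Nat.le_add_right _ _)))
    ((Nat.lt_size_self _).trans_le (Nat.pow_le_pow_right two_pos (Nat.le_add_left _ _)))

theorem complement (hm : Computes x (fun a => encodeNat (m a)))
    (hN : Computes x (fun a => encodeUnary (N a))) :
    Computes x (fun a => encodeNat (2 ^ N a - (m a % 2 ^ N a + 1))) := by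
  refine ofTestBit (b := fun a i => !(m a).testBit i) hN
    (((hm.comp_fst _).testBit (refl _).snd).bit not) (fun a => ?_) fun a i hi => ?_
  · exact Nat.sub_lt (by positivity) (Nat.succ_pos _)
  · rw [Nat.testBit_two_pow_sub_succ (Nat.mod_lt _ (by positivity)), Nat.testBit_mod_two_pow]
    simp [hi]

theorem sub (hm : Computes x (fun a => encodeNat (m a)))
    (hn : Computes x (fun a => encodeNat (n a))) :
    Computes x (fun a => encodeNat (m a - n a)) := by
  have hsum := (hm.complement hm.size).add hn
  refine ((hsum.shiftRight hm.size).eqZero.iteNat (hsum.complement hm.size) (constNat 0)).of_eq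
    (fun _ => rfl) fun a => congrArg encodeNat ?_
  have hlt := Nat.lt_size_self (m a)
  simp only [Nat.mod_eq_of_lt hlt, decide_eq_true_eq, Nat.div_eq_zero_iff]
  split_ifs with h
  · rw [Nat.mod_eq_of_lt (by omega)]
    omega
  · omega

theorem le (hm : Computes x (fun a => encodeNat (m a)))
    (hn : Computes x (fun a => encodeNat (n a))) :
    Computes x (fun a => [decide (m a ≤ n a)]) :=
  (hm.sub hn).eqZero.of_eq (fun _ => rfl) fun a => by simp only [Nat.sub_eq_zero_iff_le]

theorem unaryToBinary (hN : Computes x (fun a => encodeUnary (N a))) :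
    Computes x (fun a => encodeNat (N a)) :=
  recurrenceNat (r := fun _ i => i) hN (constNat 0) ((refl _).snd.snd.add (constNat 1))
    hN.polyBounded_unary fun _ _ hi => Nat.size_le.2 (hi.trans_lt Nat.lt_two_pow_self)

theorem sum {T : α → ℕ → ℕ} {g : α → ℕ} (hN : Computes x (fun a => encodeUnary (N a)))
    (hT : Computes (fun p : α × ℕ => pairWord (x p.1) (encodeUnary p.2))
      (fun p => encodeNat (T p.1 p.2)))
    (hg : PolyBounded x g) (hlt : ∀ a, ∑ i ∈ Finset.range (N a), T a i < 2 ^ g a) :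
    Computes x (fun a => encodeNat (∑ i ∈ Finset.range (N a), T a i)) :=
  recurrenceNat (r := fun a i => ∑ j ∈ Finset.range i, T a j) hN (constNat 0)
    (((refl _).snd.snd.add (hT.withState _)).of_eq
      (fun _ => rfl) fun _ => by rw [Finset.sum_range_succ])
    hg fun a _ hi => Nat.size_le.2
      ((Finset.sum_le_sum_of_subset (Finset.range_mono hi)).trans_lt (hlt a))

theorem mul (hm : Computes x (fun a => encodeNat (m a)))
    (hn : Computes x (fun a => encodeNat (n a))) :
    Computes x (fun a => encodeNat (m a * n a)) := by
  have heq (a : α) : m a * n a =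
      ∑ i ∈ Finset.range (n a).size, if (n a).testBit i then m a * 2 ^ i else 0 := by
    rw [sum_ite_testBit, Nat.mod_eq_of_lt (Nat.lt_size_self _)]
  refine (sum hn.size (((hn.comp_fst _).testBit (refl _).snd).iteNat
      ((hm.comp_fst _).shiftLeft (refl _).snd) (constNat 0))
    (hm.polyBounded_size.add hn.polyBounded_size) fun a => ?_).of_eq (fun _ => rfl)
    fun a => by rw [heq]
  rw [← heq, ← Nat.size_le]
  exact size_mul_le _ _

theorem constPow (q : ℕ) (hN : Computes x (fun a => encodeUnary (N a))) :
    Computes x (fun a => encodeNat (q ^ N a)) := by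
  refine recurrenceNat (r := fun _ i => q ^ i) hN (constNat 1)
    ((refl _).snd.snd.mul (constNat q))
    (((PolyBounded.const q.size).mul hN.polyBounded_unary).add (.const 1)) fun a i hi => ?_
  rw [Nat.size_le]
  calc q ^ i ≤ (2 ^ q.size) ^ i := Nat.pow_le_pow_left (Nat.lt_size_self q).le i
    _ = 2 ^ (q.size * i) := (pow_mul _ _ _).symm
    _ < 2 ^ (q.size * N a + 1) := Nat.pow_lt_pow_right one_lt_two
      (Nat.lt_succ_of_le (Nat.mul_le_mul_left _ hi))

theorem twoPowMod (hN : Computes x (fun a => encodeUnary (N a)))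
    (hn : Computes x (fun a => encodeNat (n a))) (hlt : ∀ a, 1 < n a) :
    Computes x (fun a => encodeNat (2 ^ N a % n a)) := by
  have hstep : Computes (fun p : α × ℕ => pairWord (x p.1) (pairWord (encodeUnary p.2)
      (encodeNat (2 ^ p.2 % n p.1)))) (fun p => encodeNat (2 * (2 ^ p.2 % n p.1))) :=
    (refl _).snd.snd.double
  refine recurrenceNat (r := fun a i => 2 ^ i % n a) hN
    ((constNat 1).of_eq (fun _ => rfl) fun a => by rw [pow_zero, Nat.mod_eq_of_lt (hlt a)])
    ((((hn.comp_fst _).le hstep).iteNat (hstep.sub (hn.comp_fst _)) hstep).of_eq (fun _ => rfl)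
      fun p => by simp only [pow_succ, mul_two, Nat.add_mod_eq_ite, two_mul, decide_eq_true_eq])
    hn.polyBounded_size fun a i _ => ?_
  exact Nat.size_le_size (Nat.mod_lt _ (zero_lt_one.trans (hlt a))).le

theorem twoPowDiv (hN : Computes x (fun a => encodeUnary (N a)))
    (hn : Computes x (fun a => encodeNat (n a))) (hlt : ∀ a, 1 < n a) :
    Computes x (fun a => encodeNat (2 ^ N a / n a)) := by
  have hmod : Computes (fun p : α × ℕ => pairWord (x p.1) (encodeUnary p.2))
      (fun p => encodeNat (2 ^ p.2 % n p.1)) :=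
    (refl _).snd.twoPowMod (hn.comp_fst _) fun p => hlt p.1
  refine recurrenceNat (r := fun a i => 2 ^ i / n a) hN
    ((constNat 0).of_eq (fun _ => rfl) fun a => by rw [pow_zero, Nat.div_eq_of_lt (hlt a)])
    (((refl _).snd.snd.doubleAddBit
      (((hn.comp_fst _).le hmod.double).withState _)).of_eq (fun _ => rfl) fun p => ?_)
    (hN.polyBounded_unary.add (.const 1)) fun a i hi => ?_
  · rw [pow_succ, mul_two, Nat.add_div (zero_lt_one.trans (hlt p.1)), ← two_mul, ← two_mul,
      Bool.toNat, Bool.cond_decide]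
  · have := size_div_le (2 ^ i) (n a)
    rw [Nat.size_pow] at this
    omega

end Computes

end Arithmetic

section Integers

variable {α : Type} {x : α → List Bool} {n N : α → ℕ} {z : α → ℤ} {c : α → Bool}

/-- A transducer that turns the encoding of an index into the pair of its two parts. -/
def indexTransducer : Transducer where
  Q := Bool
  start := true
  next q b := q && b
  emit q b := if q && b then [true, true] else [b]
  final _ := []
  width := 2
  emit_le := by rintro (_ | _) (_ | _) <;> simp
  final_le := by simp

theorem indexTransducer_out_false (l : List Bool) : indexTransducer.out false l = l := by
  induction l with
  | nil => rfl
  | cons b l ih => simpa [Transducer.out, indexTransducer] using ih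

namespace Computes

theorem natAbs (h : Computes x (fun a => encodeInt (z a))) :
    Computes x (fun a => encodeNat (z a).natAbs) :=
  h.tail

theorem decideNeg (h : Computes x (fun a => encodeInt (z a))) :
    Computes x (fun a => [decide (z a < 0)]) :=
  h.headD

theorem signed (hc : Computes x (fun a => [c a])) (hn : Computes x (fun a => encodeNat (n a))) :
    Computes x (fun a => encodeInt (if c a then -(n a : ℤ) else n a)) :=
  (hn.eqZero.ite (const [false]) (hc.append hn)).of_eq (fun _ => rfl) fun a => by
    rcases Nat.eq_zero_or_pos (n a) with h | h
    · simp [h, encodeInt, encodeNat_eq_bits]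
    · cases c a <;> simp [h, h.ne', encodeInt]

theorem index (hN : Computes x (fun a => encodeUnary (N a)))
    (hz : Computes x (fun a => encodeInt (z a))) : Computes x (fun a => encodeIndex (N a, z a)) :=
  hN.append (hz.cons false)

theorem indexPair : Computes encodeIndex (fun p => pairWord (encodeUnary p.1) (encodeInt p.2)) :=
  ((refl _).transduce indexTransducer).of_eq (fun _ => rfl) fun ⟨n, k⟩ => by
    change pairWord (List.replicate n true) _ =
      indexTransducer.out true (List.replicate n true ++ false :: encodeInt k)
    induction n with
    | zero => exact congrArg (false :: ·) (indexTransducer_out_false _).symm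
    | succ n ih => simpa [pairWord, Transducer.out, indexTransducer, List.replicate_succ] using ih

end Computes

end Integers

end Binary

/-! ### Polynomial-time computable real numbers -/

section Approximation

open Computability (encodeNat)

section Reals

/-- Division by `2 ^ (S + 1)`, rounded to a nearest integer. -/
def roundShift (n S : ℕ) : ℕ :=
  (n + 2 ^ S) / 2 ^ (S + 1)

theorem abs_two_pow_mul_roundShift_sub_le (n S : ℕ) :
    |(2 : ℝ) ^ (S + 1) * roundShift n S - n| ≤ 2 ^ S := by
  have hdiv := Nat.div_add_mod (n + 2 ^ S) (2 ^ (S + 1))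
  have hmod := Nat.mod_lt (n + 2 ^ S) (show 0 < 2 ^ (S + 1) by positivity)
  rw [← Nat.cast_ofNat, ← Nat.cast_pow, ← Nat.cast_pow, ← Nat.cast_mul, abs_sub_le_iff,
    sub_le_iff_le_add, sub_le_iff_le_add, ← Nat.cast_add, ← Nat.cast_add, Nat.cast_le, Nat.cast_le,
    roundShift]
  rw [pow_succ] at hdiv hmod ⊢
  omega

theorem abs_two_pow_mul_sub_roundShift_le {r : ℝ} {n S a : ℕ}
    (h : |2 ^ (n + S + 1) * r - a| ≤ 2 ^ S) : |2 ^ n * r - roundShift a S| ≤ 1 := by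
  have hS : (0 : ℝ) < 2 ^ (S + 1) := by positivity
  refine le_of_mul_le_mul_left ?_ hS
  calc 2 ^ (S + 1) * |2 ^ n * r - roundShift a S|
      = |(2 ^ (n + S + 1) * r - a) - (2 ^ (S + 1) * roundShift a S - a)| := by
        rw [← abs_of_pos hS, ← abs_mul, abs_of_pos hS]
        congr 1
        ring
    _ ≤ 2 ^ S + 2 ^ S := (abs_sub _ _).trans (add_le_add h (abs_two_pow_mul_roundShift_sub_le a S))
    _ = 2 ^ (S + 1) * 1 := by ring

theorem Computes.roundShift {α : Type} {x : α → List Bool} {n S : α → ℕ}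
    (hn : Computes x (fun a => encodeNat (n a))) (hS : Computes x (fun a => encodeUnary (S a))) :
    Computes x (fun a => encodeNat (PeriodicHeat.roundShift (n a) (S a))) :=
  (hn.add hS.twoPow).shiftRight (hS.addUnary (.constUnary 1))

/-- The nonnegative real number `r` is computable in polynomial time, by approximations in `ℕ`
instead of `ℤ`. -/
def NatApproximable (r : ℝ) : Prop :=
  ∃ A : ℕ → ℕ, (∀ n, |2 ^ n * r - A n| ≤ 1) ∧ Computes encodeUnary (fun n => encodeNat (A n))

theorem PolyTimeReal.natApproximable {r : ℝ} (h : PolyTimeReal r) (hr : 0 ≤ r) :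
    NatApproximable r := by
  obtain ⟨a, ha, hc⟩ := h
  refine ⟨fun n => (a n).natAbs, fun n => ?_, (polyTime_iff_computes.1 hc).natAbs⟩
  have hn : (0 : ℝ) < 2 ^ n := by positivity
  calc |2 ^ n * r - (a n).natAbs| = abs (|2 ^ n * r| - |(a n : ℝ)|) := by
        rw [abs_of_nonneg (mul_nonneg hn.le hr), Nat.cast_natAbs, Int.cast_abs]
    _ ≤ |2 ^ n * r - a n| := abs_abs_sub_abs_le _ _
    _ = 2 ^ n * |r - a n / 2 ^ n| := by
        rw [← abs_of_pos hn, ← abs_mul, abs_of_pos hn, mul_sub, mul_div_cancel₀ _ hn.ne']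
    _ ≤ 2 ^ n * (1 / 2 ^ n) := by gcongr; exact ha n
    _ = 1 := mul_one_div_cancel hn.ne'

theorem NatApproximable.nonneg {r : ℝ} (h : NatApproximable r) : 0 ≤ r := by
  obtain ⟨A, hA, -⟩ := h
  by_contra! hr
  obtain ⟨n, hn⟩ := pow_unbounded_of_one_lt (1 / -r) one_lt_two
  rw [div_lt_iff₀ (neg_pos.2 hr)] at hn
  linarith [(abs_le.1 (hA n)).1, (A n).cast_nonneg (α := ℝ)]

theorem natApproximable_natCast (m : ℕ) : NatApproximable m :=
  ⟨fun n => m * 2 ^ n, fun n => by simp [mul_comm],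
    (Computes.constNat m).mul (Computes.refl _).twoPow⟩

theorem norm_mul_sub_mul_le {R : Type*} [NormedRing R] (r s a c : R) :
    ‖r * s - a * c‖ ≤ ‖r‖ * ‖s - c‖ + ‖r - a‖ * ‖c‖ := by
  rw [← sub_add_sub_cancel (r * s) (r * c), ← mul_sub, ← sub_mul]
  exact norm_add_le_of_le (norm_mul_le _ _) (norm_mul_le _ _)

theorem norm_two_pow_mul_mul_sub_mul_le {𝕜 : Type*} [RCLike 𝕜] {r s a c : 𝕜} {b M : ℕ}
    (hr : ‖r‖ ≤ 2 ^ b) (hs : ‖s‖ + 1 ≤ 2 ^ b) (ha : ‖2 ^ M * r - a‖ ≤ 1)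
    (hc : ‖2 ^ M * s - c‖ ≤ 1) : ‖2 ^ (M + M) * (r * s) - a * c‖ ≤ 2 ^ (M + b + 1) := by
  have hnorm (z : 𝕜) : ‖2 ^ M * z‖ = 2 ^ M * ‖z‖ := by rw [norm_mul, norm_pow, RCLike.norm_ofNat]
  have hM : (1 : ℝ) ≤ 2 ^ M := one_le_pow₀ one_le_two
  have hc' : ‖c‖ ≤ 2 ^ M * 2 ^ b := by
    calc ‖c‖ ≤ ‖2 ^ M * s‖ + 1 :=
          sub_le_iff_le_add'.1 ((norm_sub_norm_le _ _).trans ((norm_sub_rev _ _).trans_le hc))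
      _ ≤ 2 ^ M * (‖s‖ + 1) := by rw [hnorm]; linarith
      _ ≤ 2 ^ M * 2 ^ b := by gcongr
  calc ‖2 ^ (M + M) * (r * s) - a * c‖ = ‖2 ^ M * r * (2 ^ M * s) - a * c‖ := by
        rw [pow_add, mul_mul_mul_comm]
    _ ≤ 2 ^ M * ‖r‖ * ‖2 ^ M * s - c‖ + ‖2 ^ M * r - a‖ * ‖c‖ := by
        simpa only [hnorm] using norm_mul_sub_mul_le (2 ^ M * r) (2 ^ M * s) a c
    _ ≤ 2 ^ M * 2 ^ b * 1 + 1 * (2 ^ M * 2 ^ b) := by gcongr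
    _ = 2 ^ (M + b + 1) := by ring

theorem NatApproximable.mul {r s : ℝ} (hr : NatApproximable r) (hs : NatApproximable s) :
    NatApproximable (r * s) := by
  obtain ⟨A, hA, hAc⟩ := hr
  obtain ⟨B, hB, hBc⟩ := hs
  obtain ⟨b, hb⟩ := pow_unbounded_of_one_lt (max |r| (|s| + 1)) one_lt_two
  let M (n : ℕ) := n + (b + 2)
  have hM : Computes encodeUnary (fun n => encodeUnary (M n)) :=
    (Computes.refl _).addUnary (.constUnary _)
  refine ⟨fun n => roundShift (A (M n) * B (M n)) (n + (2 * b + 3)), fun n => ?_,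
    ((hM.trans (hAc.comp M)).mul (hM.trans (hBc.comp M))).roundShift
      ((Computes.refl _).addUnary (.constUnary _))⟩
  refine abs_two_pow_mul_sub_roundShift_le ?_
  have h := norm_two_pow_mul_mul_sub_mul_le (𝕜 := ℝ) ((le_max_left _ _).trans hb.le)
    ((le_max_right _ _).trans hb.le) (hA (M n)) (hB (M n))
  rw [Nat.cast_mul, ← Real.norm_eq_abs]
  convert! h using 2 <;> simp only [M] <;> ring_nf

end Reals

section Pi

theorem sub_one_lt_natCast_div (m d : ℕ) : (m : ℝ) / d - 1 < (m / d : ℕ) := by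
  rw [← Nat.floor_div_eq_div (K := ℝ)]
  exact Nat.sub_one_lt_floor _

/-- The denominator of the `j`-th term of the series of `arctan (1 / q)`. -/
def arctanDenom (q j : ℕ) : ℕ :=
  (2 * j + 1) * q ^ (2 * j + 1)

variable {q : ℕ}

theorem hasSum_arctanDenom (hq : 1 < q) :
    HasSum (fun j : ℕ => (-1) ^ j * (1 / (arctanDenom q j : ℝ))) (Real.arctan (1 / q)) := by
  have hnorm : ‖(1 / q : ℝ)‖ < 1 := by
    rw [Real.norm_of_nonneg (by positivity), div_lt_one (by positivity)]
    exact_mod_cast hq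
  convert! Real.hasSum_arctan hnorm using 2 with j
  rw [one_div_pow, ← mul_one_div ((-1 : ℝ) ^ j * _), arctanDenom]
  push_cast
  field_simp

theorem monotone_arctanDenom (hq : 0 < q) : Monotone (arctanDenom q) := fun i j h => by
  unfold arctanDenom
  gcongr

theorem antitone_one_div_arctanDenom (hq : 0 < q) :
    Antitone fun j => 1 / (arctanDenom q j : ℝ) := fun i j h =>
  one_div_le_one_div_of_le (by unfold arctanDenom; positivity)
    (Nat.cast_le.2 (monotone_arctanDenom hq h))

theorem one_div_arctanDenom_le (hq : 1 < q) (j : ℕ) : 1 / (arctanDenom q j : ℝ) ≤ 1 / 2 ^ j := by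
  refine one_div_le_one_div_of_le (by positivity) ?_
  have hle : 2 ^ j ≤ arctanDenom q j := calc
    2 ^ j ≤ q ^ j := by gcongr; exact hq
    _ ≤ q ^ (2 * j + 1) := Nat.pow_le_pow_right (by omega) (by omega)
    _ ≤ arctanDenom q j := Nat.le_mul_of_pos_left _ (by omega)
  exact_mod_cast hle

theorem sum_range_two_mul_alternating (t : ℕ → ℝ) (M : ℕ) :
    ∑ j ∈ Finset.range (2 * M), (-1) ^ j * t j =
      ∑ i ∈ Finset.range M, (t (2 * i) - t (2 * i + 1)) := by
  induction M with
  | zero => simp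
  | succ M ih =>
    rw [mul_add_one, Finset.sum_range_succ, Finset.sum_range_succ, ih, Finset.sum_range_succ,
      pow_succ, pow_mul, neg_one_sq, one_pow]
    ring

theorem abs_arctan_sub_sum_le (hq : 1 < q) (M : ℕ) :
    |Real.arctan (1 / q) - ∑ i ∈ Finset.range M,
      (1 / (arctanDenom q (2 * i) : ℝ) - 1 / (arctanDenom q (2 * i + 1) : ℝ))| ≤ 1 / 2 ^ M := by
  have hlim := (hasSum_arctanDenom hq).tendsto_sum_nat
  have hanti := antitone_one_div_arctanDenom (zero_lt_one.trans hq)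
  have hlower := hanti.alternating_series_le_tendsto hlim M
  have hupper := hanti.tendsto_le_alternating_series hlim M
  rw [Finset.sum_range_succ, pow_mul, neg_one_sq, one_pow, one_mul] at hupper
  rw [sum_range_two_mul_alternating fun j => 1 / (arctanDenom q j : ℝ)] at hlower hupper
  rw [abs_of_nonneg (sub_nonneg.2 hlower), sub_le_iff_le_add']
  refine hupper.trans (add_le_add_right ((one_div_arctanDenom_le hq _).trans ?_) _)
  exact one_div_le_one_div_of_le (by positivity) (pow_le_pow_right₀ one_le_two (by omega))

/-- An integer approximation of `2 ^ M * arctan (1 / q)`, from the first `2 * M` terms of the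
series. -/
def arctanApprox (q M : ℕ) : ℕ :=
  ∑ i ∈ Finset.range M, (2 ^ M / arctanDenom q (2 * i) - 2 ^ M / arctanDenom q (2 * i + 1))

theorem abs_natCast_div_sub_div_sub_le {n d e : ℕ} (hd : 0 < d) (h : d ≤ e) :
    |n * (1 / (d : ℝ) - 1 / e) - (n / d - n / e : ℕ)| ≤ 1 := by
  have hd' := sub_one_lt_natCast_div n d
  have he' := sub_one_lt_natCast_div n e
  have hd'' := Nat.cast_div_le (α := ℝ) (m := n) (n := d)
  have he'' := Nat.cast_div_le (α := ℝ) (m := n) (n := e)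
  rw [Nat.cast_sub (Nat.div_le_div_left h hd), mul_sub, mul_one_div, mul_one_div, abs_sub_le_iff]
  constructor <;> linarith

theorem abs_two_pow_mul_arctan_sub_le (hq : 1 < q) (M : ℕ) :
    |2 ^ M * Real.arctan (1 / q) - arctanApprox q M| ≤ M + 1 := by
  set s : ℝ := ∑ i ∈ Finset.range M,
    (1 / (arctanDenom q (2 * i) : ℝ) - 1 / (arctanDenom q (2 * i + 1) : ℝ)) with hs
  have hseries : |2 ^ M * Real.arctan (1 / q) - 2 ^ M * s| ≤ 1 := by
    rw [← mul_sub, abs_mul, abs_of_pos (by positivity)]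
    calc 2 ^ M * |Real.arctan (1 / q) - s| ≤ 2 ^ M * (1 / 2 ^ M) := by
          gcongr
          exact abs_arctan_sub_sum_le hq M
      _ = 1 := mul_one_div_cancel (by positivity)
  have hround : |2 ^ M * s - arctanApprox q M| ≤ M := by
    rw [hs, arctanApprox, Nat.cast_sum, Finset.mul_sum, ← Finset.sum_sub_distrib]
    refine (Finset.abs_sum_le_sum_abs _ _).trans
      ((Finset.sum_le_card_nsmul _ _ 1 fun i _ => ?_).trans (by simp))
    rw [show (2 : ℝ) ^ M = (2 ^ M : ℕ) by push_cast; rfl]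
    exact abs_natCast_div_sub_div_sub_le (by unfold arctanDenom; positivity)
      (monotone_arctanDenom (zero_lt_one.trans hq) (Nat.le_succ _))
  linarith [abs_sub_le (2 ^ M * Real.arctan (1 / q)) (2 ^ M * s) (arctanApprox q M)]

theorem arctanApprox_lt_two_pow (q M : ℕ) : arctanApprox q M < 2 ^ (M + M) :=
  calc arctanApprox q M ≤ ∑ _i ∈ Finset.range M, 2 ^ M :=
        Finset.sum_le_sum fun i _ => (Nat.sub_le _ _).trans (Nat.div_le_self _ _)
    _ = M * 2 ^ M := by rw [Finset.sum_const, Finset.card_range, smul_eq_mul]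
    _ < 2 ^ M * 2 ^ M := by gcongr; exact Nat.lt_two_pow_self
    _ = 2 ^ (M + M) := (pow_add 2 M M).symm

theorem Computes.twoPowDivArctanDenom (hq : 1 < q) {α : Type} {x : α → List Bool} {j M : α → ℕ}
    (hM : Computes x (fun a => encodeUnary (M a))) (hj : Computes x (fun a => encodeUnary (j a))) :
    Computes x (fun a => encodeNat (2 ^ M a / arctanDenom q (j a))) := by
  have hodd : Computes x (fun a => encodeUnary (2 * j a + 1)) :=
    (hj.constMulUnary 2).addUnary (.constUnary 1)
  refine hM.twoPowDiv (hodd.unaryToBinary.mul (hodd.constPow q)) fun a => ?_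
  exact (Nat.one_lt_pow (by omega) hq).trans_le (Nat.le_mul_of_pos_left _ (by omega))

theorem computes_arctanApprox (hq : 1 < q) :
    Computes encodeUnary (fun M => encodeNat (arctanApprox q M)) := by
  have hid := Computes.refl encodeUnary
  have hM := hid.comp_fst fun p => encodeUnary p.2
  have hi := (Computes.refl fun p : ℕ × ℕ => pairWord (encodeUnary p.1) (encodeUnary p.2)).snd
  have hi' := hi.constMulUnary 2
  exact hid.sum ((hM.twoPowDivArctanDenom hq hi').sub
    (hM.twoPowDivArctanDenom hq (hi'.addUnary (.constUnary 1))))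
    (hid.polyBounded_unary.add hid.polyBounded_unary)
    (arctanApprox_lt_two_pow q)

theorem natApproximable_pi : NatApproximable Real.pi := by
  let M (n : ℕ) := n + (n + 9) + 1
  have hn := Computes.refl encodeUnary
  have hM : Computes encodeUnary (fun n => encodeUnary (M n)) :=
    (hn.addUnary (hn.addUnary (.constUnary 9))).addUnary (.constUnary 1)
  refine ⟨fun n => roundShift (4 * (arctanApprox 2 (M n) + arctanApprox 3 (M n))) (n + 9),
    fun n => abs_two_pow_mul_sub_roundShift_le ?_,
    ((Computes.constNat 4).mul ((hM.trans ((computes_arctanApprox one_lt_two).comp M)).add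
      (hM.trans ((computes_arctanApprox (by norm_num)).comp M)))).roundShift
      (hn.addUnary (.constUnary 9))⟩
  change |2 ^ M n * Real.pi - _| ≤ _
  have htwo := abs_two_pow_mul_arctan_sub_le one_lt_two (M n)
  have hthree := abs_two_pow_mul_arctan_sub_le (q := 3) (by norm_num) (M n)
  have hpi : Real.pi = 4 * (Real.arctan (1 / (2 : ℕ)) + Real.arctan (1 / (3 : ℕ))) := by
    have := Real.arctan_inv_2_add_arctan_inv_3
    norm_num at this ⊢
    linarith
  have hM' : 8 * ((M n : ℝ) + 1) ≤ 2 ^ (n + 9) := by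
    have hpow : n + 1 ≤ 2 ^ n := Nat.lt_two_pow_self
    have : 8 * (M n + 1) ≤ 2 ^ (n + 9) := by
      rw [pow_add]
      simp only [M]
      omega
    exact_mod_cast this
  rw [hpi]
  push_cast at htwo hthree ⊢
  rw [abs_le] at *
  constructor <;> nlinarith

end Pi

section Exponential

theorem abs_pow_sub_pow_le_of_le_one {a b : ℝ} (ha : 0 ≤ a) (ha' : a ≤ 1) (hb : 0 ≤ b) (hb' : b ≤ 1)
    (n : ℕ) : |a ^ n - b ^ n| ≤ n * |a - b| := by
  refine (abs_pow_sub_pow_le a b n).trans ?_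
  rw [abs_of_nonneg ha, abs_of_nonneg hb, mul_comm |a - b|]
  exact mul_le_of_le_one_right (by positivity)
    (pow_le_one₀ (ha.trans (le_max_left _ _)) (max_le ha' hb'))

theorem abs_exp_neg_sub_pow_le {x : ℝ} (hx : 0 ≤ x) {m : ℕ} (hm : x ≤ 2 ^ m) :
    |Real.exp (-x) - (1 - x / 2 ^ m) ^ 2 ^ m| ≤ x ^ 2 / 2 ^ m := by
  set y := x / 2 ^ m with hy
  have hy0 : 0 ≤ y := by positivity
  have hy1 : y ≤ 1 := (div_le_one (by positivity)).2 hm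
  have hexp : |Real.exp (-y) - (1 - y)| ≤ y ^ 2 := by
    have h := Real.abs_exp_sub_one_sub_id_le (x := -y) (by rwa [abs_neg, abs_of_nonneg hy0])
    rwa [neg_sq, sub_neg_eq_add, sub_add] at h
  calc |Real.exp (-x) - (1 - y) ^ 2 ^ m| = |Real.exp (-y) ^ 2 ^ m - (1 - y) ^ 2 ^ m| := by
        rw [← Real.exp_nat_mul, hy]
        push_cast
        rw [mul_neg, mul_div_cancel₀ _ (by positivity)]
    _ ≤ (2 ^ m : ℕ) * |Real.exp (-y) - (1 - y)| :=
        abs_pow_sub_pow_le_of_le_one (Real.exp_pos _).le (Real.exp_le_one_iff.2 (by linarith))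
          (by linarith) (by linarith) _
    _ ≤ (2 ^ m : ℕ) * y ^ 2 := by gcongr
    _ = x ^ 2 / 2 ^ m := by
        rw [hy]
        push_cast
        field_simp

theorem abs_natCast_div_sub_le (m d : ℕ) : |((m / d : ℕ) : ℝ) - m / d| ≤ 1 := by
  have h := sub_one_lt_natCast_div m d
  have h' := Nat.cast_div_le (α := ℝ) (m := m) (n := d)
  rw [abs_sub_le_iff]
  constructor <;> linarith

/-- Repeated squaring of `z / 2 ^ P` with `P` binary digits: the `i`-th value, divided by `2 ^ P`,
approximates `(z / 2 ^ P) ^ 2 ^ i`. -/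
def squarings (P z : ℕ) : ℕ → ℕ :=
  Nat.rec z fun _ y => y * y / 2 ^ P

theorem squarings_succ (P z i : ℕ) :
    squarings P z (i + 1) = squarings P z i * squarings P z i / 2 ^ P := rfl

variable {P z : ℕ}

theorem squarings_le (hz : z ≤ 2 ^ P) (i : ℕ) : squarings P z i ≤ 2 ^ P := by
  induction i with
  | zero => exact hz
  | succ i ih => exact Nat.div_le_of_le_mul (Nat.mul_le_mul ih ih)

theorem abs_sq_div_sub_mul_sq_le {y Q : ℕ} (hy : y ≤ Q) {w : ℝ} (hw : 0 ≤ w) (hw' : w ≤ 1) :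
    |((y * y / Q : ℕ) : ℝ) - Q * w ^ 2| ≤ 2 * |(y : ℝ) - Q * w| + 1 := by
  rcases Nat.eq_zero_or_pos Q with rfl | hQ
  · simpa using by positivity
  have hQ' : (0 : ℝ) < Q := Nat.cast_pos.2 hQ
  have hsq := abs_pow_sub_pow_le_of_le_one (by positivity)
    ((div_le_one hQ').2 (Nat.cast_le.2 hy)) hw hw' 2
  have hexact : |((y * y : ℕ) : ℝ) / Q - Q * w ^ 2| ≤ 2 * |(y : ℝ) - Q * w| := by
    calc |((y * y : ℕ) : ℝ) / Q - Q * w ^ 2| = Q * |((y : ℝ) / Q) ^ 2 - w ^ 2| := by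
          rw [← abs_of_pos hQ', ← abs_mul, abs_of_pos hQ']
          congr 1
          push_cast
          field_simp
      _ ≤ Q * (2 * |(y : ℝ) / Q - w|) := by gcongr; exact_mod_cast hsq
      _ = 2 * |(y : ℝ) - Q * w| := by
          rw [mul_left_comm, ← abs_of_pos hQ', ← abs_mul, abs_of_pos hQ', mul_sub,
            mul_div_cancel₀ _ hQ'.ne']
  linarith [abs_sub_le ((y * y / Q : ℕ) : ℝ) (((y * y : ℕ) : ℝ) / Q) (Q * w ^ 2),
    abs_natCast_div_sub_le (y * y) Q]

theorem abs_squarings_sub_le (hz : z ≤ 2 ^ P) {w : ℝ} (hw : 0 ≤ w) (hw' : w ≤ 1)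
    (h : |z - 2 ^ P * w| ≤ 2) (i : ℕ) :
    |squarings P z i - 2 ^ P * w ^ 2 ^ i| ≤ 3 * 2 ^ i - 1 := by
  induction i with
  | zero => exact (by simpa using h : |z - 2 ^ P * w ^ 2 ^ 0| ≤ 2).trans (by norm_num)
  | succ i ih =>
    have hstep := abs_sq_div_sub_mul_sq_le (squarings_le hz i) (pow_nonneg hw (2 ^ i))
      (pow_le_one₀ hw hw')
    rw [squarings_succ, pow_succ 2 i, pow_mul]
    push_cast at hstep
    linarith [pow_succ (2 : ℝ) i]

theorem Computes.squarings {α : Type} {x : α → List Bool} {P z N : α → ℕ}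
    (hP : Computes x (fun a => encodeUnary (P a))) (hz : Computes x (fun a => encodeNat (z a)))
    (hN : Computes x (fun a => encodeUnary (N a))) (hle : ∀ a, z a ≤ 2 ^ P a) :
    Computes x (fun a => encodeNat (PeriodicHeat.squarings (P a) (z a) (N a))) := by
  have hid := Computes.refl fun p : α × ℕ => pairWord (x p.1) (pairWord (encodeUnary p.2)
    (encodeNat (PeriodicHeat.squarings (P p.1) (z p.1) p.2)))
  refine recurrenceNat (r := fun a => PeriodicHeat.squarings (P a) (z a)) hN hz
    ((hid.snd.snd.mul hid.snd.snd).shiftRight (hid.fst.trans (hP.comp Prod.fst)))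
    (hP.polyBounded_unary.add (.const 1)) fun a i _ => ?_
  rw [Nat.size_le]
  exact (squarings_le (hle a) i).trans_lt (Nat.pow_lt_pow_right one_lt_two (Nat.lt_succ_self _))

theorem abs_two_pow_mul_exp_neg_sub_squarings_le {x : ℝ} {m : ℕ} (hx : 0 ≤ x) (hm : x ≤ 2 ^ m)
    (hz : z ≤ 2 ^ P) (h : |z - 2 ^ P * (1 - x / 2 ^ m)| ≤ 2) :
    |2 ^ P * Real.exp (-x) - squarings P z m| ≤ 2 ^ P * (x ^ 2 / 2 ^ m) + 3 * 2 ^ m := by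
  set w := 1 - x / 2 ^ m
  have hw0 : 0 ≤ w := sub_nonneg.2 ((div_le_one (by positivity)).2 hm)
  have hw1 : w ≤ 1 := sub_le_self _ (by positivity)
  have hexp : |2 ^ P * Real.exp (-x) - 2 ^ P * w ^ 2 ^ m| ≤ 2 ^ P * (x ^ 2 / 2 ^ m) := by
    rw [← mul_sub, abs_mul, abs_of_pos (by positivity)]
    gcongr
    exact abs_exp_neg_sub_pow_le hx hm
  have hsq := abs_squarings_sub_le hz hw0 hw1 h m
  rw [abs_sub_comm] at hsq
  linarith [abs_sub_le (2 ^ P * Real.exp (-x)) (2 ^ P * w ^ 2 ^ m) (squarings P z m)]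

theorem abs_natCast_sub_sub_le {Q q : ℕ} {v : ℝ} (hv : v ≤ Q) :
    |((Q - q : ℕ) : ℝ) - (Q - v)| ≤ |q - v| := by
  have hcast : ((Q - q : ℕ) : ℝ) = max ((Q : ℝ) - q) 0 := by
    rcases le_total q Q with h | h
    · rw [Nat.cast_sub h, max_eq_left (sub_nonneg.2 (Nat.cast_le.2 h))]
    · rw [Nat.sub_eq_zero_of_le h, Nat.cast_zero, max_eq_right (sub_nonpos.2 (Nat.cast_le.2 h))]
  calc |((Q - q : ℕ) : ℝ) - (Q - v)| = |max ((Q : ℝ) - q) 0 - max (Q - v) 0| := by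
        rw [hcast, max_eq_left (sub_nonneg.2 hv)]
    _ ≤ |((Q : ℝ) - q) - (Q - v)| := abs_max_sub_max_le_abs _ _ _
    _ = |q - v| := by rw [sub_sub_sub_cancel_left, abs_sub_comm]

theorem abs_natCast_mul_div_sub_le {a c d : ℕ} {r : ℝ} (h : |r - a| ≤ 1) (hcd : c ≤ d) :
    |((a * c / d : ℕ) : ℝ) - r * (c / d)| ≤ 2 := by
  have hle : (c / d : ℝ) ≤ 1 := div_le_one_of_le₀ (Nat.cast_le.2 hcd) d.cast_nonneg
  have hmul : |((a * c : ℕ) : ℝ) / d - r * (c / d)| ≤ 1 := by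
    rw [Nat.cast_mul, mul_div_assoc, ← sub_mul, abs_mul, abs_sub_comm, abs_div, Nat.abs_cast,
      Nat.abs_cast]
    exact mul_le_one₀ h (by positivity) hle
  linarith [abs_sub_le ((a * c / d : ℕ) : ℝ) (((a * c : ℕ) : ℝ) / d) (r * (c / d)),
    abs_natCast_div_sub_le (a * c) d]

theorem abs_two_pow_sub_div_sub_le {s : ℝ} {m a k : ℕ} (ha : |2 ^ P * s - a| ≤ 1)
    (hs : s * k ^ 2 ≤ 2 ^ m) (hk : k * k ≤ 2 ^ m) :
    |((2 ^ P - a * (k * k) / 2 ^ m : ℕ) : ℝ) - 2 ^ P * (1 - s * k ^ 2 / 2 ^ m)| ≤ 2 := by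
  have hround := abs_natCast_mul_div_sub_le ha hk
  have hle : 2 ^ P * s * ((k * k : ℕ) / (2 ^ m : ℕ)) ≤ ((2 ^ P : ℕ) : ℝ) := by
    have := (div_le_one (by positivity)).2 hs
    push_cast
    rw [mul_assoc, ← mul_div_assoc, ← sq]
    exact mul_le_of_le_one_right (by positivity) this
  convert! (abs_natCast_sub_sub_le hle).trans hround using 3
  push_cast
  ring

theorem mul_sq_le_two_pow {s : ℝ} {b : ℕ} (hs : s ≤ 2 ^ b) (k : ℕ) :
    s * k ^ 2 ≤ 2 ^ (b + 2 * k.size) := by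
  have hk : (k : ℝ) ≤ 2 ^ k.size := by exact_mod_cast k.lt_size_self.le
  rw [pow_add, mul_comm 2, pow_mul]
  gcongr

/-- The number of squarings in the approximation of `2 ^ n * exp (-(s * k ^ 2))` for `s ≤ 2 ^ b`,
chosen so that `(s * k ^ 2) ^ 2 / 2 ^ expDepth b n k ≤ 1 / (2 ^ n * 4)`. -/
def expDepth (b n k : ℕ) : ℕ :=
  n + (4 * k.size + (2 * b + 2))

theorem two_pow_expDepth (b n k : ℕ) :
    (2 : ℝ) ^ expDepth b n k = 2 ^ n * 4 * (2 ^ (b + 2 * k.size)) ^ 2 := by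
  rw [expDepth]
  ring

/-- The number of binary digits of the intermediate results in the approximation of
`2 ^ n * exp (-(s * k ^ 2))`, chosen so that the rounding errors, which double with every squaring,
stay below `2 ^ (expDepth b n k + 2)`. -/
def expPrecision (b n k : ℕ) : ℕ :=
  n + (expDepth b n k + 3) + 1

theorem abs_two_pow_mul_exp_neg_sub_squarings_le_two_pow {s : ℝ} {a b n k : ℕ} (hs : 0 ≤ s)
    (hsb : s ≤ 2 ^ b) (ha : |2 ^ expPrecision b n k * s - a| ≤ 1) :
    |2 ^ expPrecision b n k * Real.exp (-(s * k ^ 2)) -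
      squarings (expPrecision b n k)
        (2 ^ expPrecision b n k - a * (k * k) / 2 ^ expDepth b n k) (expDepth b n k)| ≤
      2 ^ (expDepth b n k + 3) := by
  have hdepth := two_pow_expDepth b n k
  have hprec : (2 : ℝ) ^ expPrecision b n k = 2 ^ n * (2 ^ expDepth b n k * 16) := by
    rw [expPrecision]
    ring
  have hk : k * k ≤ 2 ^ expDepth b n k := by
    rw [← sq, expDepth]
    calc k ^ 2 ≤ (2 ^ k.size) ^ 2 := Nat.pow_le_pow_left k.lt_size_self.le 2
      _ ≤ 2 ^ (n + (4 * k.size + (2 * b + 2))) := by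
        rw [← pow_mul]
        exact Nat.pow_le_pow_right two_pos (by omega)
  have hx : s * k ^ 2 ≤ 2 ^ (b + 2 * k.size) := mul_sq_le_two_pow hsb k
  have hxm : s * k ^ 2 ≤ 2 ^ expDepth b n k :=
    hx.trans (pow_le_pow_right₀ one_le_two (by rw [expDepth]; omega))
  generalize expPrecision b n k = P at *
  generalize expDepth b n k = m at *
  have hsq : (s * k ^ 2) ^ 2 / 2 ^ m ≤ 1 / (2 ^ n * 4) := by
    rw [div_le_div_iff₀ (by positivity) (by positivity), hdepth, one_mul, mul_comm]
    gcongr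
  calc |2 ^ P * Real.exp (-(s * k ^ 2)) - squarings P (2 ^ P - a * (k * k) / 2 ^ m) m|
      ≤ 2 ^ P * ((s * k ^ 2) ^ 2 / 2 ^ m) + 3 * 2 ^ m :=
        abs_two_pow_mul_exp_neg_sub_squarings_le (by positivity) hxm (Nat.sub_le _ _)
          (abs_two_pow_sub_div_sub_le ha hxm hk)
    _ ≤ 2 ^ P * (1 / (2 ^ n * 4)) + 4 * 2 ^ m := by gcongr; norm_num
    _ = 2 ^ (m + 3) := by
        rw [hprec]
        field_simp
        ring

theorem exists_exp_approx {s : ℝ} (hs : NatApproximable s) :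
    ∃ E : ℕ × ℕ → ℕ, (∀ n k : ℕ, |2 ^ n * Real.exp (-(s * k ^ 2)) - E (n, k)| ≤ 1) ∧
      Computes (fun p => pairWord (encodeUnary p.1) (encodeNat p.2))
        (fun p => encodeNat (E p)) := by
  have hs0 : 0 ≤ s := hs.nonneg
  obtain ⟨A, hA, hAc⟩ := hs
  obtain ⟨b, hb⟩ := pow_unbounded_of_one_lt s one_lt_two
  let m (p : ℕ × ℕ) := expDepth b p.1 p.2
  let P (p : ℕ × ℕ) := expPrecision b p.1 p.2
  let z (p : ℕ × ℕ) := 2 ^ P p - A (P p) * (p.2 * p.2) / 2 ^ m p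
  have hid := Computes.refl fun p : ℕ × ℕ => pairWord (encodeUnary p.1) (encodeNat p.2)
  have hm : Computes _ (fun p => encodeUnary (m p)) :=
    hid.fst.addUnary ((hid.snd.size.constMulUnary 4).addUnary (.constUnary _))
  have hS := hm.addUnary (.constUnary 3)
  have hP : Computes _ (fun p => encodeUnary (P p)) :=
    (hid.fst.addUnary hS).addUnary (.constUnary 1)
  have hz : Computes _ (fun p => encodeNat (z p)) :=
    hP.twoPow.sub (((hP.trans (hAc.comp P)).mul (hid.snd.mul hid.snd)).shiftRight hm)
  exact ⟨fun p => roundShift (squarings (P p) (z p) (m p)) (m p + 3),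
    fun n k => abs_two_pow_mul_sub_roundShift_le
      (abs_two_pow_mul_exp_neg_sub_squarings_le_two_pow hs0 hb.le (hA (P (n, k)))),
    (hP.squarings hz hm fun p => Nat.sub_le _ _).roundShift hS⟩

end Exponential

section Damping

/-- Division by `2 ^ (S + 1)`, rounded to a nearest integer. -/
def roundShiftInt (z : ℤ) (S : ℕ) : ℤ :=
  z.sign * roundShift z.natAbs S

theorem abs_two_pow_mul_roundShiftInt_sub_le (z : ℤ) (S : ℕ) :
    |(2 : ℝ) ^ (S + 1) * roundShiftInt z S - z| ≤ 2 ^ S := by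
  have hz : (z : ℝ) = z.sign * z.natAbs := by
    rw [← Int.cast_natCast, ← Int.cast_mul, Int.sign_mul_natAbs]
  have hsign : |(z.sign : ℝ)| ≤ 1 := by
    rcases lt_trichotomy z 0 with h | rfl | h
    · simp [Int.sign_eq_neg_one_of_neg h]
    · simp
    · simp [Int.sign_eq_one_of_pos h]
  have hround := abs_two_pow_mul_roundShift_sub_le z.natAbs S
  calc |(2 : ℝ) ^ (S + 1) * roundShiftInt z S - z|
      = |(z.sign : ℝ)| * |(2 : ℝ) ^ (S + 1) * roundShift z.natAbs S - z.natAbs| := by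
        rw [← abs_mul]
        congr 1
        conv_lhs => rw [hz]
        rw [roundShiftInt]
        push_cast
        ring
    _ ≤ 1 * 2 ^ S := by gcongr
    _ = 2 ^ S := one_mul _

/-- `roundShiftInt` in both components. -/
def roundShiftGaussian (g : GaussianInt) (S : ℕ) : GaussianInt :=
  ⟨roundShiftInt g.re S, roundShiftInt g.im S⟩

theorem norm_two_pow_mul_roundShiftGaussian_sub_le (g : GaussianInt) (S : ℕ) :
    ‖2 ^ (S + 1) * GaussianInt.toComplex (roundShiftGaussian g S) - GaussianInt.toComplex g‖ ≤
      3 / 2 * 2 ^ S := by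
  have hsqrt : √2 ≤ 3 / 2 := Real.sqrt_le_iff.2 ⟨by norm_num, by norm_num⟩
  have hpow : (2 : ℂ) ^ (S + 1) = ((2 ^ (S + 1) : ℝ) : ℂ) := by push_cast; rfl
  refine (Complex.norm_le_sqrt_two_mul_max _).trans ?_
  gcongr
  rw [hpow, Complex.sub_re, Complex.sub_im, Complex.re_ofReal_mul, Complex.im_ofReal_mul,
    ← GaussianInt.intCast_re, ← GaussianInt.intCast_re, ← GaussianInt.intCast_im,
    ← GaussianInt.intCast_im]
  exact max_le (abs_two_pow_mul_roundShiftInt_sub_le _ _) (abs_two_pow_mul_roundShiftInt_sub_le _ _)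

theorem norm_two_pow_mul_sub_roundShiftGaussian_le {z : ℂ} {g : GaussianInt} {n S : ℕ}
    (h : ‖2 ^ (n + S + 2) * z - GaussianInt.toComplex g‖ ≤ 2 ^ S) :
    ‖2 ^ n * z - GaussianInt.toComplex (roundShiftGaussian g (S + 1))‖ ≤ 1 := by
  set w := GaussianInt.toComplex (roundShiftGaussian g (S + 1))
  have hround := norm_two_pow_mul_roundShiftGaussian_sub_le g (S + 1)
  refine le_of_mul_le_mul_left ?_ (show (0 : ℝ) < 2 ^ (S + 2) by positivity)
  calc 2 ^ (S + 2) * ‖2 ^ n * z - w‖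
      = ‖(2 ^ (n + S + 2) * z - GaussianInt.toComplex g) -
          (2 ^ (S + 1 + 1) * w - GaussianInt.toComplex g)‖ := by
        rw [← Complex.norm_two, ← norm_pow, ← norm_mul]
        congr 1
        ring
    _ ≤ 2 ^ S + 3 / 2 * 2 ^ (S + 1) := norm_sub_le_of_le h hround
    _ = 2 ^ (S + 2) * 1 := by ring

variable {α : Type} {x : α → List Bool} {n S : α → ℕ} {z : α → ℤ}

theorem Computes.roundShiftInt (hz : Computes x (fun a => encodeInt (z a)))
    (hS : Computes x (fun a => encodeUnary (S a))) :
    Computes x (fun a => encodeInt (PeriodicHeat.roundShiftInt (z a) (S a))) :=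
  (hz.decideNeg.signed (hz.natAbs.roundShift hS)).of_eq (fun _ => rfl) fun a => by
    rw [PeriodicHeat.roundShiftInt]
    rcases lt_trichotomy (z a) 0 with h | h | h
    · simp [Int.sign_eq_neg_one_of_neg, h]
    · simp [h, PeriodicHeat.roundShift, Nat.div_eq_of_lt (Nat.pow_lt_pow_succ one_lt_two)]
    · simp [Int.sign_eq_one_of_pos, h, h.not_gt]

theorem Computes.natMulInt (hn : Computes x (fun a => encodeNat (n a)))
    (hz : Computes x (fun a => encodeInt (z a))) : Computes x (fun a => encodeInt (n a * z a)) :=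
  (hz.decideNeg.signed (hn.mul hz.natAbs)).of_eq (fun _ => rfl) fun a => by
    rcases lt_or_ge (z a) 0 with h | h
    · simp [h, abs_of_neg h]
    · simp [h.not_gt, abs_of_nonneg h]

/-- The family `F` of complex numbers is computable in polynomial time, in the sense in which
Fourier coefficients are. -/
def PolyTimeFamily (F : ℤ → ℂ) : Prop :=
  ∃ c : ℤ → ℕ → GaussianInt,
    (∀ k n, ‖F k - GaussianInt.toComplex (c k n) / 2 ^ n‖ ≤ 1 / 2 ^ n) ∧
    PolyTime encodeIndex encodeInt (fun p => (c p.2 p.1).re) ∧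
    PolyTime encodeIndex encodeInt (fun p => (c p.2 p.1).im)

theorem norm_sub_div_two_pow_le_iff {z w : ℂ} {n : ℕ} :
    ‖z - w / 2 ^ n‖ ≤ 1 / 2 ^ n ↔ ‖2 ^ n * z - w‖ ≤ 1 := by
  have hpos : (0 : ℝ) < 2 ^ n := by positivity
  rw [le_div_iff₀' hpos, ← Complex.norm_two, ← norm_pow, ← norm_mul, mul_sub,
    mul_div_cancel₀ _ (pow_ne_zero n two_ne_zero)]

theorem PolyTimeFamily.ofReal_mul {r : ℤ → ℝ} {E : ℕ × ℤ → ℕ} {F : ℤ → ℂ} {B : ℝ}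
    (hF : PolyTimeFamily F) (hB : ∀ k, ‖F k‖ ≤ B) (hr : ∀ k, |r k| ≤ 1)
    (hE : ∀ n k, |2 ^ n * r k - E (n, k)| ≤ 1)
    (hEc : Computes encodeIndex (fun p => encodeNat (E p))) :
    PolyTimeFamily fun k => r k * F k := by
  obtain ⟨c, hc, hre, him⟩ := hF
  obtain ⟨b, hb⟩ := pow_unbounded_of_one_lt (B + 1) one_lt_two
  let M (n : ℕ) := n + (b + 3)
  let S (n : ℕ) := n + (2 * b + 4)
  have hn := Computes.indexPair.fst
  have hindex := (hn.addUnary (.constUnary (b + 3))).index Computes.indexPair.snd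
  have hE' := hindex.trans (hEc.comp fun p : ℕ × ℤ => (M p.1, p.2))
  have hround {d : ℕ × ℤ → ℤ} (hd : PolyTime encodeIndex encodeInt d) : PolyTime encodeIndex
      encodeInt fun p => roundShiftInt (E (M p.1, p.2) * d (M p.1, p.2)) (S p.1 + 1) :=
    polyTime_iff_computes.2 <| (hE'.natMulInt (hindex.trans
      ((polyTime_iff_computes.1 hd).comp fun p : ℕ × ℤ => (M p.1, p.2)))).roundShiftInt
        ((hn.addUnary (.constUnary _)).addUnary (.constUnary 1))
  refine ⟨fun k n => roundShiftGaussian (E (M n, k) * c k (M n)) (S n + 1), fun k n =>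
    norm_sub_div_two_pow_le_iff.2 (norm_two_pow_mul_sub_roundShiftGaussian_le ?_),
    by simpa [roundShiftGaussian] using hround hre, by simpa [roundShiftGaussian] using hround him⟩
  have hr' : ‖(r k : ℂ)‖ ≤ 2 ^ b :=
    ((Complex.norm_real _).trans_le (hr k)).trans (one_le_pow₀ one_le_two)
  have hE'' : ‖2 ^ M n * (r k : ℂ) - (E (M n, k) : ℕ)‖ ≤ 1 := by
    have h := hE (M n) k
    rw [← Real.norm_eq_abs, ← Complex.norm_real] at h
    exact_mod_cast h
  convert! norm_two_pow_mul_mul_sub_mul_le hr' ((add_le_add_left (hB k) 1).trans hb.le) hE''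
    (norm_sub_div_two_pow_le_iff.1 (hc k (M n))) using 2
  · rw [map_mul, map_natCast]
    simp only [M, S]
    ring_nf
  · simp only [M, S]
    ring

theorem PolyTimeFamily.exp_neg_mul_sq_mul {s B : ℝ} {F : ℤ → ℂ} (hF : PolyTimeFamily F)
    (hB : ∀ k, ‖F k‖ ≤ B) (hs : NatApproximable s) :
    PolyTimeFamily fun k => Real.exp (-(s * k ^ 2)) * F k := by
  have hs0 := hs.nonneg
  obtain ⟨E, hE, hEc⟩ := exists_exp_approx hs
  refine hF.ofReal_mul (E := fun p => E (p.1, p.2.natAbs)) hB (fun k => ?_) (fun n k => ?_)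
    ((Computes.indexPair.fst.pair Computes.indexPair.snd.natAbs).trans
      (hEc.comp fun p : ℕ × ℤ => (p.1, p.2.natAbs)))
  · rw [Real.abs_exp]
    exact Real.exp_le_one_iff.2 (neg_nonpos.2 (by positivity))
  · have h := hE n k.natAbs
    rwa [Nat.cast_natAbs, Int.cast_abs, sq_abs] at h

end Damping

end Approximation

/-! ### Fourier coefficients and L² estimates -/

section Fourier

open MeasureTheory Filter

/-- The character `exp(2πikx)`, which spans the `k`-th term of a Fourier series on `[0, 1]`. -/
def mode (k : ℤ) (x : ℝ) : ℂ :=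
  Complex.exp (2 * Real.pi * Complex.I * k * x)

theorem norm_mode (k : ℤ) (x : ℝ) : ‖mode k x‖ = 1 := by
  have h : (2 * Real.pi * Complex.I * k * x : ℂ) = ((2 * Real.pi * k * x : ℝ) : ℂ) * Complex.I := by
    push_cast; ring
  rw [mode, h, Complex.norm_exp_ofReal_mul_I]

theorem mode_zero (x : ℝ) : mode 0 x = 1 := by simp [mode]

theorem mode_mul (j k : ℤ) (x : ℝ) : mode j x * mode k x = mode (j + k) x := by
  rw [mode, mode, mode, ← Complex.exp_add]
  congr 1
  push_cast
  ring

theorem periodic_mode (k : ℤ) : Function.Periodic (mode k) 1 := by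
  intro x
  have h : (2 * Real.pi * Complex.I * k * ((x + 1 : ℝ) : ℂ) : ℂ) =
      2 * Real.pi * Complex.I * k * x + k * (2 * Real.pi * Complex.I) := by
    push_cast; ring
  rw [mode, h, Complex.exp_add, Complex.exp_int_mul_two_pi_mul_I, mul_one, mode]

theorem hasDerivAt_mode (k : ℤ) (x : ℝ) :
    HasDerivAt (mode k) (2 * Real.pi * Complex.I * k * mode k x) x := by
  have hcexp : HasDerivAt (fun y : ℂ => Complex.exp (2 * Real.pi * Complex.I * k * y))
      (Complex.exp (2 * Real.pi * Complex.I * k * x) * (2 * Real.pi * Complex.I * k * 1)) x :=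
    ((hasDerivAt_id (x : ℂ)).const_mul _).cexp
  refine hcexp.comp_ofReal.congr_deriv ?_
  rw [mode]
  ring

theorem continuous_mode (k : ℤ) : Continuous (mode k) := by
  unfold mode
  fun_prop

theorem unitMeasure_eq_restrict_Ioc : unitMeasure = volume.restrict (Set.Ioc 0 1) :=
  Measure.restrict_congr_set Ioc_ae_eq_Icc.symm

instance : IsProbabilityMeasure unitMeasure :=
  ⟨by simp [unitMeasure]⟩

theorem integral_unitMeasure {E : Type*} [NormedAddCommGroup E] [NormedSpace ℝ E] (g : ℝ → E) :
    ∫ x, g x ∂unitMeasure = ∫ x in (0 : ℝ)..1, g x := by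
  rw [unitMeasure_eq_restrict_Ioc, intervalIntegral.integral_of_le zero_le_one]

theorem memLp_unitMeasure_of_continuous {E : Type*} [NormedAddCommGroup E] {g : ℝ → E}
    (hg : Continuous g) (p : ENNReal) : MemLp g p unitMeasure := by
  obtain ⟨C, hC⟩ := (isCompact_Icc (a := (0 : ℝ)) (b := 1)).exists_bound_of_continuousOn
    hg.continuousOn
  refine MemLp.of_bound hg.aestronglyMeasurable C ?_
  exact (ae_restrict_iff' measurableSet_Icc).2 (Eventually.of_forall hC)

theorem integrable_unitMeasure_of_continuous {E : Type*} [NormedAddCommGroup E] {g : ℝ → E}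
    (hg : Continuous g) : Integrable g unitMeasure :=
  memLp_one_iff_integrable.1 (memLp_unitMeasure_of_continuous hg 1)

theorem fourierCoefficient_eq_integral_mode (g : ℝ → ℂ) (k : ℤ) :
    fourierCoefficient g k = ∫ x, mode (-k) x * g x ∂unitMeasure := by
  refine integral_congr_ae (Eventually.of_forall fun x => ?_)
  simp only [mode]
  congr 2
  push_cast
  ring

theorem integrable_mode_mul {g : ℝ → ℂ} (hg : Integrable g unitMeasure) (k : ℤ) :
    Integrable (fun x => mode k x * g x) unitMeasure :=
  hg.bdd_mul (c := 1) (continuous_mode k).aestronglyMeasurable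
    (Eventually.of_forall fun x => (norm_mode k x).le)

theorem norm_fourierCoefficient_le (g : ℝ → ℂ) (k : ℤ) :
    ‖fourierCoefficient g k‖ ≤ ∫ x, ‖g x‖ ∂unitMeasure := by
  rw [fourierCoefficient_eq_integral_mode]
  refine (norm_integral_le_integral_norm _).trans_eq ?_
  simp [norm_mode]

theorem fourierCoefficient_sub {g h : ℝ → ℂ} (hg : Integrable g unitMeasure)
    (hh : Integrable h unitMeasure) (k : ℤ) :
    fourierCoefficient (fun x => g x - h x) k =
      fourierCoefficient g k - fourierCoefficient h k := by
  simp only [fourierCoefficient_eq_integral_mode, mul_sub]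
  exact integral_sub (integrable_mode_mul hg _) (integrable_mode_mul hh _)

theorem fourierCoefficient_const_mul (c : ℂ) (g : ℝ → ℂ) (k : ℤ) :
    fourierCoefficient (fun x => c * g x) k = c * fourierCoefficient g k := by
  simp only [fourierCoefficient_eq_integral_mode, mul_left_comm _ c, integral_const_mul]

theorem fourierCoefficient_tsum {ι : Type*} [Countable ι] {g : ι → ℝ → ℂ} {b : ι → ℝ}
    (hg : ∀ i, AEStronglyMeasurable (g i) unitMeasure) (hb : Summable b)
    (hgb : ∀ i x, ‖g i x‖ ≤ b i) (k : ℤ) :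
    fourierCoefficient (fun x => ∑' i, g i x) k = ∑' i, fourierCoefficient (g i) k := by
  have hint (i : ι) : Integrable (g i) unitMeasure :=
    .of_bound (hg i) (b i) (Eventually.of_forall (hgb i))
  have hnorm (i : ι) : ∫ x, ‖mode (-k) x * g i x‖ ∂unitMeasure ≤ b i := by
    simp only [norm_mul, norm_mode, one_mul]
    exact (integral_mono (hint i).norm (integrable_const _) (hgb i)).trans_eq (by simp)
  simp only [fourierCoefficient_eq_integral_mode, ← tsum_mul_left]
  exact (integral_tsum_of_summable_integral_norm (fun i => integrable_mode_mul (hint i) _)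
    (.of_nonneg_of_le (fun i => integral_nonneg fun x => norm_nonneg _) hnorm hb)).symm

theorem integral_mode (k : ℤ) : ∫ x, mode k x ∂unitMeasure = if k = 0 then 1 else 0 := by
  split_ifs with hk
  · subst hk
    simp [mode_zero]
  · have hc : (2 * Real.pi * Complex.I * k : ℂ) ≠ 0 := by
      simp [hk, Real.pi_ne_zero]
    rw [integral_unitMeasure, intervalIntegral.integral_eq_sub_of_hasDerivAt
      (f := fun x => (2 * Real.pi * Complex.I * k : ℂ)⁻¹ * mode k x)]
    · rw [(periodic_mode k).eq, sub_self]
    · intro x _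
      have h := (hasDerivAt_mode k x).const_mul (2 * Real.pi * Complex.I * k : ℂ)⁻¹
      rwa [← mul_assoc, inv_mul_cancel₀ hc, one_mul] at h
    · exact (continuous_mode k).intervalIntegrable _ _

theorem fourierCoefficient_mode (j k : ℤ) :
    fourierCoefficient (mode j) k = if j = k then 1 else 0 := by
  simp only [fourierCoefficient_eq_integral_mode, mode_mul, integral_mode, neg_add_eq_zero,
    eq_comm]

theorem fourierCoefficient_eq_fourierCoeffOn (g : ℝ → ℂ) (k : ℤ) :
    fourierCoefficient g k = fourierCoeffOn (zero_lt_one : (0 : ℝ) < 1) g k := by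
  rw [fourierCoeffOn_eq_integral, fourierCoefficient_eq_integral_mode, integral_unitMeasure,
    sub_zero, div_one, one_smul]
  refine intervalIntegral.integral_congr fun x _ => ?_
  simp only [mode, smul_eq_mul]
  rw [fourier_coe_apply]
  simp

theorem hasSum_sq_norm_fourierCoefficient {g : ℝ → ℂ} (hg : MemLp g 2 unitMeasure) :
    HasSum (fun k => ‖fourierCoefficient g k‖ ^ 2) (∫ x, ‖g x‖ ^ 2 ∂unitMeasure) := by
  rw [unitMeasure_eq_restrict_Ioc] at hg
  have h := hasSum_sq_fourierCoeffOn (zero_lt_one : (0 : ℝ) < 1) hg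
  rw [sub_zero, inv_one, one_smul, intervalIntegral.integral_of_le zero_le_one,
    ← unitMeasure_eq_restrict_Ioc] at h
  simpa only [fourierCoefficient_eq_fourierCoeffOn] using h

theorem eLpNorm_eq_sqrt_tsum {g : ℝ → ℂ} (hg : MemLp g 2 unitMeasure) :
    eLpNorm g 2 unitMeasure =
      ENNReal.ofReal (Real.sqrt (∑' k, ‖fourierCoefficient g k‖ ^ 2)) := by
  rw [hg.eLpNorm_eq_integral_rpow_norm (by simp) (by simp),
    (hasSum_sq_norm_fourierCoefficient hg).tsum_eq, Real.sqrt_eq_rpow]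
  simp

theorem continuous_fourierPartialSum (g : ℝ → ℂ) (K : ℕ) : Continuous (fourierPartialSum g K) := by
  unfold fourierPartialSum
  fun_prop

theorem fourierCoefficient_fourierPartialSum (g : ℝ → ℂ) (K : ℕ) (k : ℤ) :
    fourierCoefficient (fourierPartialSum g K) k =
      if k ∈ Finset.Icc (-(K : ℤ)) K then fourierCoefficient g k else 0 := by
  have hsum : fourierCoefficient (fourierPartialSum g K) k =
      ∑ j ∈ Finset.Icc (-(K : ℤ)) K, fourierCoefficient g j * fourierCoefficient (mode j) k := by
    simp only [← fourierCoefficient_const_mul]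
    simp only [fourierCoefficient_eq_integral_mode _ k, fourierPartialSum, Finset.mul_sum]
    exact integral_finsetSum _ fun j _ => integrable_mode_mul
      ((integrable_unitMeasure_of_continuous (continuous_mode j)).const_mul _) _
  simp only [hsum, fourierCoefficient_mode, mul_ite, mul_one, mul_zero, Finset.sum_ite_eq']

theorem fourierCoefficient_sub_fourierPartialSum {g : ℝ → ℂ} (hg : Integrable g unitMeasure)
    (K : ℕ) (k : ℤ) :
    fourierCoefficient (fun x => g x - fourierPartialSum g K x) k =
      if k ∈ Finset.Icc (-(K : ℤ)) K then 0 else fourierCoefficient g k := by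
  rw [fourierCoefficient_sub hg
    (integrable_unitMeasure_of_continuous (continuous_fourierPartialSum g K)),
    fourierCoefficient_fourierPartialSum]
  split_ifs
  · exact sub_self _
  · exact sub_zero _

theorem eLpNorm_le_mul_of_norm_fourierCoefficient_le {g h : ℝ → ℂ} (hg : MemLp g 2 unitMeasure)
    (hh : MemLp h 2 unitMeasure) {ε : ℝ} (hε : 0 ≤ ε)
    (hgh : ∀ k, ‖fourierCoefficient g k‖ ≤ ε * ‖fourierCoefficient h k‖) :
    eLpNorm g 2 unitMeasure ≤ ENNReal.ofReal ε * eLpNorm h 2 unitMeasure := by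
  rw [eLpNorm_eq_sqrt_tsum hg, eLpNorm_eq_sqrt_tsum hh, ← ENNReal.ofReal_mul hε]
  refine ENNReal.ofReal_le_ofReal (Real.sqrt_le_iff.2 ⟨by positivity, ?_⟩)
  rw [mul_pow, Real.sq_sqrt (tsum_nonneg fun k => sq_nonneg _), ← tsum_mul_left]
  refine (hasSum_sq_norm_fourierCoefficient hg).summable.tsum_le_tsum (fun k => ?_)
    ((hasSum_sq_norm_fourierCoefficient hh).summable.mul_left _)
  rw [← mul_pow]
  gcongr
  exact hgh k

theorem eLpNorm_sub_fourierPartialSum_le {g h : ℝ → ℂ} (hg : MemLp g 2 unitMeasure)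
    (hh : MemLp h 2 unitMeasure) {ε : ℝ} (hε : 0 ≤ ε) {K : ℕ}
    (hgh : ∀ k ∉ Finset.Icc (-(K : ℤ)) K,
      ‖fourierCoefficient g k‖ ≤ ε * ‖fourierCoefficient h k‖) :
    eLpNorm (fun x => g x - fourierPartialSum g K x) 2 unitMeasure ≤
      ENNReal.ofReal ε * eLpNorm h 2 unitMeasure := by
  refine eLpNorm_le_mul_of_norm_fourierCoefficient_le
    (g := fun x => g x - fourierPartialSum g K x)
    (hg.sub (memLp_unitMeasure_of_continuous (continuous_fourierPartialSum g K) 2)) hh hε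
    fun k => ?_
  rw [fourierCoefficient_sub_fourierPartialSum (hg.integrable one_le_two)]
  split_ifs with hk
  · rw [norm_zero]
    positivity
  · exact hgh k hk

theorem ae_eq_of_fourierCoefficient_eq {g h : ℝ → ℂ} (hg : MemLp g 2 unitMeasure)
    (hh : MemLp h 2 unitMeasure)
    (hgh : ∀ k, fourierCoefficient g k = fourierCoefficient h k) : g =ᵐ[unitMeasure] h := by
  have hcoeff (k : ℤ) : fourierCoefficient (g - h) k = 0 :=
    (fourierCoefficient_sub (hg.integrable one_le_two) (hh.integrable one_le_two) k).trans
      (sub_eq_zero.2 (hgh k))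
  have hnorm : eLpNorm (g - h) 2 unitMeasure = 0 := by
    rw [eLpNorm_eq_sqrt_tsum (hg.sub hh)]
    simp [hcoeff]
  rw [eLpNorm_eq_zero_iff (hg.sub hh).aestronglyMeasurable two_ne_zero] at hnorm
  exact sub_ae_eq_zero g h |>.1 hnorm

theorem eq_of_fourierCoefficient_eq {g h : ℝ → ℂ} (hg : Continuous g) (hh : Continuous h)
    (hgper : Function.Periodic g 1) (hhper : Function.Periodic h 1)
    (hgh : ∀ k, fourierCoefficient g k = fourierCoefficient h k) : g = h := by
  have hae : g =ᵐ[volume.restrict (Set.Icc 0 1)] h :=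
    ae_eq_of_fourierCoefficient_eq (memLp_unitMeasure_of_continuous hg 2)
      (memLp_unitMeasure_of_continuous hh 2) hgh
  have hIcc : Set.EqOn g h (Set.Icc 0 1) :=
    Measure.eqOn_Icc_of_ae_eq volume zero_ne_one hae hg.continuousOn hh.continuousOn
  funext x
  obtain ⟨y, hy, hxy⟩ := (hgper.sub hhper).exists_mem_Ico₀ zero_lt_one x
  refine sub_eq_zero.1 (hxy.trans ?_)
  exact sub_eq_zero.2 (hIcc (Set.Ico_subset_Icc_self hy))

end Fourier

/-! ### Solution by damped Fourier series -/

section Heat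

open MeasureTheory Filter Topology

/-- The factor `exp(-4π²k²s)` by which the heat flow multiplies the `k`-th Fourier coefficient in
time `s`. -/
def decay (k : ℤ) (s : ℝ) : ℝ :=
  Real.exp (-(4 * Real.pi ^ 2 * s * (k : ℝ) ^ 2))

theorem decay_pos (k : ℤ) (s : ℝ) : 0 < decay k s := Real.exp_pos _

theorem decay_zero (k : ℤ) : decay k 0 = 1 := by simp [decay]

theorem decay_antitone (k : ℤ) : Antitone (decay k) := by
  intro s t hst
  unfold decay
  gcongr

theorem decay_le_one (k : ℤ) {s : ℝ} (hs : 0 ≤ s) : decay k s ≤ 1 :=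
  (decay_antitone k hs).trans_eq (decay_zero k)

theorem decay_mul_sq_le_one (k : ℤ) (s : ℝ) :
    4 * Real.pi ^ 2 * s * (k : ℝ) ^ 2 * decay k s ≤ 1 := by
  rw [decay, Real.exp_neg, ← div_eq_mul_inv, div_le_one (Real.exp_pos _)]
  linarith [Real.add_one_le_exp (4 * Real.pi ^ 2 * s * (k : ℝ) ^ 2)]

theorem decay_le_of_notMem_Icc {K : ℕ} (hK : 0 < K) {k : ℤ} (hk : k ∉ Finset.Icc (-(K : ℤ)) K)
    {s : ℝ} (hs : 0 < s) : decay k s ≤ 1 / (4 * Real.pi ^ 2 * s * (K : ℝ) ^ 2) := by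
  have hKk : (K : ℝ) ≤ |(k : ℝ)| := by
    rw [Finset.mem_Icc, ← abs_le, not_le] at hk
    exact_mod_cast hk.le
  rw [le_div_iff₀ (by positivity), mul_comm]
  refine le_trans ?_ (decay_mul_sq_le_one k s)
  rw [← sq_abs (k : ℝ)]
  have := decay_pos k s
  gcongr

theorem continuous_decay (k : ℤ) : Continuous (decay k) := by
  unfold decay
  fun_prop

theorem hasDerivAt_decay (k : ℤ) (s : ℝ) :
    HasDerivAt (fun s => (decay k s : ℂ)) ((2 * Real.pi * Complex.I * k) ^ 2 * decay k s) s := by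
  have h : HasDerivAt (fun s => -(4 * Real.pi ^ 2 * s * (k : ℝ) ^ 2))
      (-(4 * Real.pi ^ 2 * 1 * (k : ℝ) ^ 2)) s :=
    (((hasDerivAt_id s).const_mul _).mul_const _).neg
  refine h.exp.ofReal_comp.congr_deriv ?_
  rw [mul_pow, mul_pow, Complex.I_sq]
  unfold decay
  push_cast
  ring

theorem summable_pow_mul_decay (j : ℕ) {s : ℝ} (hs : 0 < s) :
    Summable fun k : ℤ => (2 * Real.pi * |(k : ℝ)|) ^ j * decay k s := by
  have h := (summable_pow_mul_jacobiTheta₂_term_bound 0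
    (T := 4 * Real.pi * s) (by positivity) j).mul_left ((2 * Real.pi) ^ j)
  refine h.congr fun k => ?_
  rw [decay, mul_pow (2 * Real.pi), mul_assoc ((2 * Real.pi) ^ j), Int.cast_abs]
  congr 3
  ring

/-- The general term of the `j`-th space derivative of the solution of the heat equation whose
initial datum has Fourier coefficients `a`. -/
def heatTerm (a : ℤ → ℂ) (j : ℕ) (k : ℤ) (x s : ℝ) : ℂ :=
  (2 * Real.pi * Complex.I * k) ^ j * decay k s * a k * mode k x

/-- The `j`-th space derivative of the solution of the heat equation whose initial datum has
Fourier coefficients `a`. -/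
def heatSeries (a : ℤ → ℂ) (j : ℕ) (x s : ℝ) : ℂ :=
  ∑' k, heatTerm a j k x s

variable {a : ℤ → ℂ} {B : ℝ}

theorem norm_heatTerm_le (ha : ∀ k, ‖a k‖ ≤ B) (j : ℕ) (k : ℤ) (x : ℝ) {r s : ℝ} (hrs : r ≤ s) :
    ‖heatTerm a j k x s‖ ≤ (2 * Real.pi * |(k : ℝ)|) ^ j * decay k r * B := by
  have hB := ha k
  have hd := decay_antitone k hrs
  have hd' := (decay_pos k r).le
  have hk : ‖(2 * Real.pi * Complex.I * k : ℂ)‖ = 2 * Real.pi * |(k : ℝ)| := by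
    simp [abs_of_pos Real.pi_pos]
  rw [heatTerm, norm_mul, norm_mode, mul_one, norm_mul, norm_mul, norm_pow, hk, Complex.norm_real,
    Real.norm_of_nonneg (decay_pos k s).le]
  gcongr

theorem summable_heatTerm (ha : ∀ k, ‖a k‖ ≤ B) (j : ℕ) (x : ℝ) {s : ℝ} (hs : 0 < s) :
    Summable fun k => heatTerm a j k x s :=
  .of_norm_bounded ((summable_pow_mul_decay j hs).mul_right B) fun k =>
    norm_heatTerm_le ha j k x le_rfl

theorem continuousOn_heatSeries (ha : ∀ k, ‖a k‖ ≤ B) (j : ℕ) :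
    ContinuousOn (Function.uncurry (heatSeries a j)) (Set.univ ×ˢ Set.Ioi 0) := by
  rintro ⟨x, s⟩ ⟨-, hs⟩
  have hs : 0 < s := hs
  have hcont : ContinuousOn (fun p : ℝ × ℝ => ∑' k, heatTerm a j k p.1 p.2)
      (Set.univ ×ˢ Set.Ici (s / 2)) := by
    refine continuousOn_tsum (fun k => Continuous.continuousOn ?_)
      ((summable_pow_mul_decay j (half_pos hs)).mul_right B)
      fun k p hp => norm_heatTerm_le ha j k p.1 hp.2
    have := continuous_decay k
    have := continuous_mode k
    unfold heatTerm
    fun_prop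
  refine ContinuousAt.continuousWithinAt (hcont.continuousAt ?_)
  exact prod_mem_nhds univ_mem (Ici_mem_nhds (half_lt_self hs))

theorem continuous_heatSeries (ha : ∀ k, ‖a k‖ ≤ B) (j : ℕ) {s : ℝ} (hs : 0 < s) :
    Continuous fun x => heatSeries a j x s := by
  refine continuous_tsum (fun k => ?_) ((summable_pow_mul_decay j hs).mul_right B)
    fun k x => norm_heatTerm_le ha j k x le_rfl
  exact continuous_const.mul (continuous_mode k)

theorem hasDerivAt_heatSeries_space (ha : ∀ k, ‖a k‖ ≤ B) (j : ℕ) (x : ℝ) {s : ℝ} (hs : 0 < s) :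
    HasDerivAt (fun y => heatSeries a j y s) (heatSeries a (j + 1) x s) x := by
  refine hasDerivAt_tsum (g := fun k y => heatTerm a j k y s)
    (g' := fun k y => heatTerm a (j + 1) k y s) (y₀ := x)
    ((summable_pow_mul_decay (j + 1) hs).mul_right B)
    (fun k y => ?_) (fun k y => norm_heatTerm_le ha (j + 1) k y le_rfl)
    (summable_heatTerm ha j x hs) x
  refine ((hasDerivAt_mode k y).const_mul _).congr_deriv ?_
  rw [heatTerm]
  ring

theorem hasDerivAt_heatSeries_time (ha : ∀ k, ‖a k‖ ≤ B) (j : ℕ) (x : ℝ) {s : ℝ} (hs : 0 < s) :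
    HasDerivAt (fun r => heatSeries a j x r) (heatSeries a (j + 2) x s) s := by
  have hmem : s ∈ Set.Ioi (s / 2) := half_lt_self hs
  refine hasDerivAt_tsum_of_isPreconnected (t := Set.Ioi (s / 2)) (y₀ := s)
    ((summable_pow_mul_decay (j + 2) (half_pos hs)).mul_right B) isOpen_Ioi isPreconnected_Ioi
    (fun k r _ => ?_) (fun k r hr => norm_heatTerm_le ha (j + 2) k x (le_of_lt hr)) hmem
    (summable_heatTerm ha j x hs) hmem
  refine ((((hasDerivAt_decay k r).const_mul _).mul_const _).mul_const _).congr_deriv ?_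
  rw [heatTerm]
  ring

theorem fourierCoefficient_heatTerm (a : ℤ → ℂ) (j : ℕ) (i : ℤ) (s : ℝ) (k : ℤ) :
    fourierCoefficient (fun x => heatTerm a j i x s) k =
      if i = k then (2 * Real.pi * Complex.I * k) ^ j * decay k s * a k else 0 := by
  simp only [heatTerm, fourierCoefficient_const_mul, fourierCoefficient_mode, mul_ite, mul_one,
    mul_zero]
  exact ite_congr rfl (fun hik => by rw [hik]) fun _ => rfl

theorem fourierCoefficient_heatSeries (ha : ∀ k, ‖a k‖ ≤ B) (j : ℕ) {s : ℝ} (hs : 0 < s) (k : ℤ) :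
    fourierCoefficient (fun x => heatSeries a j x s) k =
      (2 * Real.pi * Complex.I * k) ^ j * decay k s * a k := by
  have hcont (i : ℤ) : Continuous fun x => heatTerm a j i x s :=
    continuous_const.mul (continuous_mode i)
  simp only [heatSeries]
  rw [fourierCoefficient_tsum (fun i => (hcont i).aestronglyMeasurable)
    ((summable_pow_mul_decay j hs).mul_right B) fun i x => norm_heatTerm_le ha j i x le_rfl]
  simp only [fourierCoefficient_heatTerm, tsum_ite_eq]

theorem periodic_heatSeries (a : ℤ → ℂ) (j : ℕ) (s : ℝ) :
    Function.Periodic (fun x => heatSeries a j x s) 1 := fun x => by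
  simp only [heatSeries, heatTerm, periodic_mode _ x]

theorem tendsto_tsum_sq_one_sub_decay_mul (ha : Summable fun k => ‖a k‖ ^ 2) :
    Tendsto (fun s => ∑' k, ((1 - decay k s) * ‖a k‖) ^ 2) (𝓝[>] 0) (𝓝 0) := by
  suffices h : Tendsto (fun s => ∑' k, ((1 - decay k s) * ‖a k‖) ^ 2) (𝓝[>] 0)
      (𝓝 (∑' _ : ℤ, 0)) by rwa [tsum_zero] at h
  refine tendsto_tsum_of_dominated_convergence ha (fun k => ?_) ?_
  · have hcont : Continuous fun s => ((1 - decay k s) * ‖a k‖) ^ 2 := by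
      have := continuous_decay k
      fun_prop
    exact (hcont.tendsto' 0 0 (by simp [decay_zero])).mono_left nhdsWithin_le_nhds
  · filter_upwards [self_mem_nhdsWithin] with s hs k
    have hpos := decay_pos k s
    have hle := decay_le_one k (le_of_lt hs)
    rw [Real.norm_of_nonneg (by positivity), mul_pow]
    exact mul_le_of_le_one_left (by positivity) (pow_le_one₀ (by linarith) (by linarith))

theorem eLpNorm_heatSeries_sub {f : ℝ → ℂ} (hf : MemLp f 2 unitMeasure) {s : ℝ} (hs : 0 < s) :
    eLpNorm (fun x => heatSeries (fourierCoefficient f) 0 x s - f x) 2 unitMeasure =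
      ENNReal.ofReal (√(∑' k, ((1 - decay k s) * ‖fourierCoefficient f k‖) ^ 2)) := by
  have ha := norm_fourierCoefficient_le f
  have hcont := continuous_heatSeries ha 0 hs
  have hcoeff (k : ℤ) :
      fourierCoefficient (fun x => heatSeries (fourierCoefficient f) 0 x s - f x) k =
        -(((1 - decay k s : ℝ) : ℂ) * fourierCoefficient f k) := by
    rw [fourierCoefficient_sub (integrable_unitMeasure_of_continuous hcont)
      (hf.integrable one_le_two), fourierCoefficient_heatSeries ha 0 hs]
    push_cast
    ring
  rw [eLpNorm_eq_sqrt_tsum (g := fun x => heatSeries (fourierCoefficient f) 0 x s - f x)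
    ((memLp_unitMeasure_of_continuous hcont 2).sub hf)]
  simp only [hcoeff, norm_neg, norm_mul, Complex.norm_real,
    Real.norm_of_nonneg (sub_nonneg.2 (decay_le_one _ hs.le))]

theorem tendsto_eLpNorm_heatSeries_sub {f : ℝ → ℂ} (hf : MemLp f 2 unitMeasure) :
    Tendsto
      (fun s => eLpNorm (fun x => heatSeries (fourierCoefficient f) 0 x s - f x) 2 unitMeasure)
      (𝓝[>] 0) (𝓝 0) := by
  have hsum := tendsto_tsum_sq_one_sub_decay_mul (hasSum_sq_norm_fourierCoefficient hf).summable
  have hlim := ENNReal.tendsto_ofReal ((Real.continuous_sqrt.tendsto' 0 0 Real.sqrt_zero).comp hsum)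
  rw [ENNReal.ofReal_zero] at hlim
  refine hlim.congr' ?_
  filter_upwards [self_mem_nhdsWithin] with s hs
  exact (eLpNorm_heatSeries_sub hf hs).symm

theorem isHeatSolution_heatSeries {f : ℝ → ℂ} (hf : MemLp f 2 unitMeasure) :
    IsHeatSolution f (heatSeries (fourierCoefficient f) 0) where
  periodic x s _ := periodic_heatSeries _ _ s x
  continuousOn := continuousOn_heatSeries (norm_fourierCoefficient_le f) 0
  equation := by
    have ha := norm_fourierCoefficient_le f
    exact ⟨_, _, continuousOn_heatSeries ha 1, continuousOn_heatSeries ha 2, fun x s hs =>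
      ⟨hasDerivAt_heatSeries_space ha 0 x hs, hasDerivAt_heatSeries_space ha 1 x hs,
        hasDerivAt_heatSeries_time ha 0 x hs⟩⟩
  initial := tendsto_eLpNorm_heatSeries_sub hf

theorem fourierCoefficient_deriv {g g' : ℝ → ℂ} (hg : ∀ x, HasDerivAt g (g' x) x)
    (hg' : Continuous g') (hper : Function.Periodic g 1) (k : ℤ) :
    fourierCoefficient g' k = 2 * Real.pi * Complex.I * k * fourierCoefficient g k := by
  simp only [fourierCoefficient_eq_integral_mode, integral_unitMeasure]
  rw [intervalIntegral.integral_mul_deriv_eq_deriv_mul (fun x _ => hasDerivAt_mode (-k) x)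
      (fun x _ => hg x)
      ((continuous_const.mul (continuous_mode _)).intervalIntegrable _ _)
      (hg'.intervalIntegrable _ _),
    ← intervalIntegral.integral_const_mul, hper.eq, (periodic_mode (-k)).eq, sub_self, zero_sub,
    ← intervalIntegral.integral_neg]
  refine intervalIntegral.integral_congr fun x _ => ?_
  push_cast
  ring

theorem periodic_deriv {g g' : ℝ → ℂ} (hg : ∀ x, HasDerivAt g (g' x) x)
    (hper : Function.Periodic g 1) : Function.Periodic g' 1 := fun x => by
  have hshift := (hg (x + 1)).comp_add_const x 1
  simp only [hper _] at hshift
  exact hshift.unique (hg x)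

theorem enorm_fourierCoefficient_le {g : ℝ → ℂ} (hg : AEStronglyMeasurable g unitMeasure)
    (k : ℤ) : ‖fourierCoefficient g k‖ₑ ≤ eLpNorm g 2 unitMeasure := by
  rw [fourierCoefficient_eq_integral_mode]
  refine (enorm_integral_le_lintegral_enorm _).trans ?_
  refine le_trans (le_of_eq ?_) (eLpNorm_le_eLpNorm_of_exponent_le one_le_two hg)
  rw [eLpNorm_one_eq_lintegral_enorm]
  refine lintegral_congr fun x => ?_
  rw [enorm_mul, ← ofReal_norm (mode _ _), norm_mode, ENNReal.ofReal_one, one_mul]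

theorem continuous_slice {w : ℝ → ℝ → ℂ}
    (hw : ContinuousOn (Function.uncurry w) (Set.univ ×ˢ Set.Ioi 0)) {s : ℝ} (hs : 0 < s) :
    Continuous fun x => w x s :=
  hw.comp_continuous (f := fun x : ℝ => (x, s)) (by fun_prop) fun _ => ⟨trivial, hs⟩

theorem hasDerivAt_fourierCoefficient {w w' : ℝ → ℝ → ℂ}
    (hw : ContinuousOn (Function.uncurry w) (Set.univ ×ˢ Set.Ioi 0))
    (hw' : ContinuousOn (Function.uncurry w') (Set.univ ×ˢ Set.Ioi 0))
    (hderiv : ∀ x s, 0 < s → HasDerivAt (fun r => w x r) (w' x s) s) (k : ℤ) {s : ℝ} (hs : 0 < s) :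
    HasDerivAt (fun r => fourierCoefficient (fun x => w x r) k)
      (fourierCoefficient (fun x => w' x s) k) s := by
  have hpos {r : ℝ} (hr : r ∈ Set.Icc (s / 2) (2 * s)) : 0 < r := (half_pos hs).trans_le hr.1
  obtain ⟨C, hC⟩ := (isCompact_Icc.prod isCompact_Icc).exists_bound_of_continuousOn
    (hw'.mono (t := Set.Icc 0 1 ×ˢ Set.Icc (s / 2) (2 * s)) fun p hp => ⟨trivial, hpos hp.2⟩)
  simp only [fourierCoefficient_eq_integral_mode]
  refine (hasDerivAt_integral_of_dominated_loc_of_deriv_le (bound := fun _ => C)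
    (F := fun r x => mode (-k) x * w x r) (F' := fun r x => mode (-k) x * w' x r)
    (Icc_mem_nhds (half_lt_self hs) (by linarith : s < 2 * s)) ?_ ?_ ?_ ?_
    (integrable_const _) ?_).2
  · filter_upwards [lt_mem_nhds hs] with r hr
    exact ((continuous_mode _).mul (continuous_slice hw hr)).aestronglyMeasurable
  · exact integrable_unitMeasure_of_continuous ((continuous_mode _).mul (continuous_slice hw hs))
  · exact ((continuous_mode _).mul (continuous_slice hw' hs)).aestronglyMeasurable
  · refine (ae_restrict_iff' measurableSet_Icc).2 (Eventually.of_forall fun x hx r hr => ?_)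
    rw [norm_mul, norm_mode, one_mul]
    exact hC (x, r) ⟨hx, hr⟩
  · exact Eventually.of_forall fun x r hr => (hderiv x r (hpos hr)).const_mul _

variable {f : ℝ → ℂ} {v : ℝ → ℝ → ℂ}

theorem IsHeatSolution.continuous_slice (hv : IsHeatSolution f v) {s : ℝ} (hs : 0 < s) :
    Continuous fun x => v x s :=
  PeriodicHeat.continuous_slice hv.continuousOn hs

theorem IsHeatSolution.periodic_slice (hv : IsHeatSolution f v) {s : ℝ} (hs : 0 < s) :
    Function.Periodic (fun x => v x s) 1 :=
  fun x => hv.periodic x s hs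

theorem IsHeatSolution.hasDerivAt_fourierCoefficient (hv : IsHeatSolution f v) (k : ℤ) {s : ℝ}
    (hs : 0 < s) :
    HasDerivAt (fun r => fourierCoefficient (fun x => v x r) k)
      ((2 * Real.pi * Complex.I * k) ^ 2 * fourierCoefficient (fun x => v x s) k) s := by
  obtain ⟨vx, vxx, hvx, hvxx, heq⟩ := hv.equation
  have hv_vx (x : ℝ) : HasDerivAt (fun y => v y s) (vx x s) x := (heq x s hs).1
  have hvx_vxx (x : ℝ) : HasDerivAt (fun y => vx y s) (vxx x s) x := (heq x s hs).2.1
  refine (PeriodicHeat.hasDerivAt_fourierCoefficient hv.continuousOn hvxx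
    (fun x r hr => (heq x r hr).2.2) k hs).congr_deriv ?_
  rw [fourierCoefficient_deriv hvx_vxx (PeriodicHeat.continuous_slice hvxx hs)
      (periodic_deriv hv_vx (hv.periodic_slice hs)),
    fourierCoefficient_deriv hv_vx (PeriodicHeat.continuous_slice hvx hs) (hv.periodic_slice hs)]
  ring

theorem IsHeatSolution.fourierCoefficient_div_decay_eq (hv : IsHeatSolution f v) (k : ℤ)
    {r s : ℝ} (hr : 0 < r) (hs : 0 < s) :
    fourierCoefficient (fun x => v x r) k / decay k r =
      fourierCoefficient (fun x => v x s) k / decay k s := by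
  have hderiv (t : ℝ) (ht : 0 < t) :
      HasDerivAt (fun t => fourierCoefficient (fun x => v x t) k / decay k t) 0 t := by
    refine ((hv.hasDerivAt_fourierCoefficient k ht).div (hasDerivAt_decay k t)
      (Complex.ofReal_ne_zero.2 (decay_pos k t).ne')).congr_deriv ?_
    ring
  exact isOpen_Ioi.is_const_of_deriv_eq_zero (s := Set.Ioi (0 : ℝ)) isPreconnected_Ioi
    (fun t ht => (hderiv t ht).differentiableAt.differentiableWithinAt)
    (fun t ht => (hderiv t ht).deriv) hr hs

theorem IsHeatSolution.tendsto_fourierCoefficient (hf : MemLp f 2 unitMeasure)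
    (hv : IsHeatSolution f v) (k : ℤ) :
    Tendsto (fun s => fourierCoefficient (fun x => v x s) k) (𝓝[>] 0)
      (𝓝 (fourierCoefficient f k)) := by
  rw [tendsto_iff_edist_tendsto_0]
  refine tendsto_of_tendsto_of_tendsto_of_le_of_le' tendsto_const_nhds hv.initial
    (Eventually.of_forall fun _ => zero_le) ?_
  filter_upwards [self_mem_nhdsWithin] with s hs
  have hvs := hv.continuous_slice hs
  rw [edist_eq_enorm_sub, ← fourierCoefficient_sub (integrable_unitMeasure_of_continuous hvs)
    (hf.integrable one_le_two)]
  exact enorm_fourierCoefficient_le (hvs.aestronglyMeasurable.sub hf.aestronglyMeasurable) k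

theorem IsHeatSolution.fourierCoefficient_eq (hf : MemLp f 2 unitMeasure)
    (hv : IsHeatSolution f v) (k : ℤ) {s : ℝ} (hs : 0 < s) :
    fourierCoefficient (fun x => v x s) k = decay k s * fourierCoefficient f k := by
  have hdecay : Tendsto (fun r => (decay k r : ℂ)) (𝓝[>] 0) (𝓝 1) :=
    ((Complex.continuous_ofReal.comp (continuous_decay k)).tendsto' 0 1
      (by simp [decay_zero])).mono_left nhdsWithin_le_nhds
  have hquot := (hv.tendsto_fourierCoefficient hf k).div hdecay one_ne_zero
  rw [div_one] at hquot
  have hconst : Tendsto (fun r => fourierCoefficient (fun x => v x r) k / decay k r) (𝓝[>] 0)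
      (𝓝 (fourierCoefficient (fun x => v x s) k / decay k s)) := by
    refine tendsto_const_nhds.congr' ?_
    filter_upwards [self_mem_nhdsWithin] with r hr
    exact hv.fourierCoefficient_div_decay_eq k hs hr
  rw [tendsto_nhds_unique hquot hconst,
    mul_div_cancel₀ _ (Complex.ofReal_ne_zero.2 (decay_pos k s).ne')]

theorem IsHeatSolution.eq_heatSeries (hf : MemLp f 2 unitMeasure) (hv : IsHeatSolution f v)
    (x : ℝ) {s : ℝ} (hs : 0 < s) : v x s = heatSeries (fourierCoefficient f) 0 x s := by
  have ha := norm_fourierCoefficient_le f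
  refine congrFun (eq_of_fourierCoefficient_eq (hv.continuous_slice hs)
    (continuous_heatSeries ha 0 hs) (hv.periodic_slice hs) (periodic_heatSeries _ _ _)
    fun k => ?_) x
  rw [hv.fourierCoefficient_eq hf k hs, fourierCoefficient_heatSeries ha 0 hs, pow_zero, one_mul]

theorem PolyTimeFamily.heatSeries (hf : PolyTimeFamily (fourierCoefficient f)) {t : ℝ}
    (ht : 0 < t) (htc : PolyTimeReal t) :
    PolyTimeFamily
      (fourierCoefficient fun x => PeriodicHeat.heatSeries (fourierCoefficient f) 0 x t) := by
  have ha := norm_fourierCoefficient_le f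
  have hrate : NatApproximable ((4 : ℕ) * (Real.pi * (Real.pi * t))) :=
    (natApproximable_natCast 4).mul
      (natApproximable_pi.mul (natApproximable_pi.mul (htc.natApproximable ht.le)))
  convert hf.exp_neg_mul_sq_mul ha hrate using 2 with k
  rw [fourierCoefficient_heatSeries ha 0 ht, pow_zero, one_mul, decay]
  congr 4
  push_cast
  ring

theorem norm_fourierCoefficient_heatSeries_le_of_notMem_Icc (f : ℝ → ℂ) {K : ℕ} (hK : 0 < K)
    {k : ℤ} (hk : k ∉ Finset.Icc (-(K : ℤ)) K) {t : ℝ} (ht : 0 < t) :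
    ‖fourierCoefficient (fun x => heatSeries (fourierCoefficient f) 0 x t) k‖ ≤
      1 / (4 * Real.pi ^ 2 * t * (K : ℝ) ^ 2) * ‖fourierCoefficient f k‖ := by
  rw [fourierCoefficient_heatSeries (norm_fourierCoefficient_le f) 0 ht, pow_zero, one_mul,
    norm_mul, Complex.norm_real, Real.norm_of_nonneg (decay_pos k t).le]
  gcongr
  exact decay_le_of_notMem_Icc hK hk ht

theorem exists_eLpNorm_heatSeries_sub_fourierPartialSum_le (hf : MemLp f 2 unitMeasure) {t : ℝ}
    (ht : 0 < t) : ∃ c : ℕ, ∀ m : ℕ,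
      eLpNorm (fun x => heatSeries (fourierCoefficient f) 0 x t -
        fourierPartialSum (fun x => heatSeries (fourierCoefficient f) 0 x t) (2 ^ (m + c)) x)
        2 unitMeasure ≤ ENNReal.ofReal (1 / 2 ^ m) := by
  set M := (eLpNorm f 2 unitMeasure).toReal with hM
  obtain ⟨c, hc⟩ := pow_unbounded_of_one_lt (M / (4 * Real.pi ^ 2 * t)) one_lt_two
  refine ⟨c, fun m => ?_⟩
  have hmem := memLp_unitMeasure_of_continuous
    (continuous_heatSeries (norm_fourierCoefficient_le f) 0 ht) 2
  refine (eLpNorm_sub_fourierPartialSum_le hmem hf (by positivity) fun k hk =>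
    norm_fourierCoefficient_heatSeries_le_of_notMem_Icc f (by positivity) hk ht).trans ?_
  rw [← ENNReal.ofReal_toReal hf.eLpNorm_ne_top, ← ENNReal.ofReal_mul (by positivity), ← hM]
  refine ENNReal.ofReal_le_ofReal ?_
  calc 1 / (4 * Real.pi ^ 2 * t * ((2 ^ (m + c) : ℕ) : ℝ) ^ 2) * M
      = M / (4 * Real.pi ^ 2 * t) / (2 ^ (m + c)) ^ 2 := by
        push_cast
        field_simp
    _ ≤ 2 ^ c / (2 ^ (m + c)) ^ 2 := by gcongr
    _ = 1 / 2 ^ m / 2 ^ (m + c) := by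
        rw [pow_add]
        field_simp
    _ ≤ 1 / 2 ^ m := div_le_self (by positivity) (one_le_pow₀ one_le_two)

theorem fourierPolyTime_heatSeries (hf : MemLp f 2 unitMeasure)
    (hfc : PolyTimeFamily (fourierCoefficient f)) {t : ℝ} (ht : 0 < t) (htc : PolyTimeReal t) :
    FourierPolyTime fun x => heatSeries (fourierCoefficient f) 0 x t where
  memLp := memLp_unitMeasure_of_continuous
    (continuous_heatSeries (norm_fourierCoefficient_le f) 0 ht) 2
  approx := hfc.heatSeries ht htc
  tail := by
    obtain ⟨c, hc⟩ := exists_eLpNorm_heatSeries_sub_fourierPartialSum_le hf ht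
    exact ⟨Polynomial.X + Polynomial.C c, fun m => by simpa using hc m⟩

end Heat

end PeriodicHeat

end

theorem theoremt_general (f : ℝ → ℂ) (hf : MeasureTheory.MemLp f 2 PeriodicHeat.unitMeasure)
    (hfc : PeriodicHeat.PolyTimeFamily (PeriodicHeat.fourierCoefficient f)) :
    ∃ u : ℝ → ℝ → ℂ,
      PeriodicHeat.IsHeatSolution f u ∧
      (∀ v : ℝ → ℝ → ℂ, PeriodicHeat.IsHeatSolution f v → ∀ x s, 0 < s → v x s = u x s) ∧
      ∀ t, 0 < t → PeriodicHeat.PolyTimeReal t →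
        PeriodicHeat.FourierPolyTime (fun x => u x t) :=
  ⟨PeriodicHeat.heatSeries (PeriodicHeat.fourierCoefficient f) 0,
    PeriodicHeat.isHeatSolution_heatSeries hf,
    fun _ hv x _ hs => hv.eq_heatSeries hf x hs,
    fun _ ht htc => PeriodicHeat.fourierPolyTime_heatSeries hf hfc ht htc⟩

theorem theoremt (t : ℝ) (ht : 0 < t) (htc : PeriodicHeat.PolyTimeReal t)
    (f : ℝ → ℂ) (hf : PeriodicHeat.FourierPolyTime f) :
    ∃ u : ℝ → ℝ → ℂ,
      PeriodicHeat.IsHeatSolution f u ∧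
      (∀ v : ℝ → ℝ → ℂ, PeriodicHeat.IsHeatSolution f v → ∀ x s, 0 < s → v x s = u x s) ∧
      PeriodicHeat.FourierPolyTime (fun x => u x t) := by
  obtain ⟨u, hu, huniq, hcomp⟩ := theoremt_general f hf.memLp hf.approx
  exact ⟨u, hu, huniq, hcomp t ht htc⟩
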